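/- Let $\mathfrak g$ be a finite-dimensional complex semisimple Lie algebra, $\mathfrak h$ a Cartan subalgebra, $\Delta_+$ a choice of positive roots for $(\mathfrak h,\mathfrak g)$, and $\mathfrak b\supset\mathfrak h$ the corresponding Borel subalgebra. Let $\mathfrak q\ne\mathfrak g$ be a proper Lie subalgebra containing $\mathfrak b$ (a standard parabolic subalgebra), $\mathfrak n$ its nilradical (its largest nilpotent ideal), and $\mathfrak m\supset\mathfrak h$ the Levi factor of $\mathfrak q$ containing $\mathfrak h$, so that $\mathfrak q=\mathfrak m\oplus\mathfrak n$. Put $\mathfrak t=\operatorname{cent}\mathfrak m$ and $\mathfrak s=[\mathfrak m,\mathfrak m]$. Let $\overline{\mathfrak n}$ be the span of the root spaces $\mathfrak g^{-\varphi}$ over all roots $\varphi$ with $\mathfrak g^{\varphi}\subset\mathfrak n$, and put $\mathfrak r=\mathfrak n+\overline{\mathfrak n}$. For $\nu\in\mathfrak t^*$ let $\mathfrak g_\nu=\{z\in\mathfrak g : [x,z]=\nu(x)z\ \ \forall x\in\mathfrak t\}$. Let $R$ be the set of $\mathfrak t$-roots, i.e. of nonzero $\nu\in\mathfrak t^*$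 with $\mathfrak g_\nu\neq 0$. Theorem 1.9. Let $\nu\in R$. Under the adjoint action $\mathfrak g_\nu$ is an irreducible $\mathfrak m$-module and an irreducible $\mathfrak s$-module. Moreover $[\mathfrak g_\nu,\mathfrak g_{-\nu}]$ (the span of all brackets) is contained in $\mathfrak m$ and is an ideal of $\mathfrak m$, and $\mathfrak g_\nu$ is a faithful irreducible module for $[\mathfrak g_\nu,\mathfrak g_{-\nu}]$ and for $\mathfrak s(\nu)=[\mathfrak g_\nu,\mathfrak g_{-\nu}]\cap\mathfrak s$. In addition, $\mathfrak r$ is an $\mathfrak m$-submodule of $\mathfrak g$, it is the direct sum $$\mathfrak r=\bigoplus_{\nu\in R}\mathfrak g_\nu ,$$ it is a multiplicity-free $\mathfrak m$-module (completely reducible, and any two isomorphic irreducible submodules are equal), and its irreducible $\mathfrak m$-submodules are exactly the $\mathfrak t$-root spaces $\mathfrak g_\nu$, $\nu\in R$. -/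

import Mathlib

/-- The Borel subalgebra `𝔟` containing the Cartan subalgebra `H` whose roots are the roots that are
positive with respect to the base `b`: the span of `H` and of the positive root spaces. -/
def borelOfBase {𝔤 : Type*} [LieRing 𝔤] [LieAlgebra ℂ 𝔤] [FiniteDimensional ℂ 𝔤]
    [LieAlgebra.IsSemisimple ℂ 𝔤] (H : LieSubalgebra ℂ 𝔤) [H.IsCartanSubalgebra]
    (b : (LieAlgebra.IsKilling.rootSystem H).Base) : LieSubalgebra ℂ 𝔤 where
  __ := Submodule.span ℂ
    ((H : Set 𝔤) ∪ {x | ∃ i : H.root, b.IsPos i ∧ x ∈ LieAlgebra.rootSpace H i.1})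
  lie_mem' := by
    intro x y hx hy
    simp only [AddSubsemigroup.mem_carrier, AddSubmonoid.mem_toSubsemigroup,
      Submodule.mem_toAddSubmonoid] at hx hy ⊢
    induction hx, hy using Submodule.span_induction₂ with
    | mem_mem x y hx hy =>
      apply Submodule.subset_span
      rcases hx with hx | ⟨i, hi, hx⟩ <;> rcases hy with hy | ⟨j, hj, hy⟩
      · exact Or.inl (H.lie_mem hx hy)
      · exact Or.inr ⟨j, hj, (LieAlgebra.rootSpace H j.1).lie_mem (x := (⟨x, hx⟩ : H)) hy⟩
      · refine Or.inr ⟨i, hi, ?_⟩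
        rw [← lie_skew]
        exact neg_mem ((LieAlgebra.rootSpace H i.1).lie_mem (x := (⟨y, hy⟩ : H)) hx)
      · have hxy := LieAlgebra.lie_mem_genWeightSpace_of_mem_genWeightSpace hx hy
        by_cases h0 : LieAlgebra.rootSpace H (i.1 + j.1 : H → ℂ) = ⊥
        · left
          have h1 : ⁅x, y⁆ ∈ (⊥ : LieSubmodule ℂ H 𝔤) := h0 ▸ hxy
          rw [(LieSubmodule.mem_bot _).mp h1]
          exact H.zero_mem
        · let k : LieModule.Weight ℂ H 𝔤 := ⟨(i.1 + j.1 : H → ℂ), h0⟩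
          by_cases hk : k.IsZero
          · left
            have h1 : (i.1 + j.1 : H → ℂ) = 0 := hk
            rw [h1] at hxy
            have h2 : ⁅x, y⁆ ∈ (LieAlgebra.rootSpace H (0 : H → ℂ)).toSubmodule := hxy
            rw [LieAlgebra.rootSpace_zero_eq] at h2
            exact h2
          · right
            refine ⟨⟨k, by simpa using hk⟩, hi.add hj ?_, hxy⟩
            ext z
            simp [k]
    | zero_left y hy => simp
    | zero_right x hx => simp
    | add_left x y z _ _ _ h1 h2 => rw [add_lie]; exact add_mem h1 h2
    | add_right x y z _ _ _ h1 h2 => rw [lie_add]; exact add_mem h1 h2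
    | smul_left r x y _ _ h => rw [smul_lie]; exact Submodule.smul_mem _ r h
    | smul_right r x y _ _ h => rw [lie_smul]; exact Submodule.smul_mem _ r h

/-- The nilradical of the subalgebra `q`, as a subspace of `𝔤`: the largest ideal of `q` that is
nilpotent as a Lie algebra. (Mathlib's `LieAlgebra.maxNilpotentIdeal` is a different notion: it asks
that the whole algebra act nilpotently on the ideal.) -/
def nilradicalSubmodule {𝔤 : Type*} [LieRing 𝔤] [LieAlgebra ℂ 𝔤] (q : LieSubalgebra ℂ 𝔤) :
    Submodule ℂ 𝔤 :=
  (sSup {I : LieIdeal ℂ q | LieRing.IsNilpotent I}).toSubmodule.map q.toSubmodule.subtype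

/-- `m` is a Levi factor of `q`: a Lie subalgebra such that `q` is, as a vector space, the direct
sum of `m` and of the nilradical of `q`. For `q` parabolic the quotient of `q` by its nilradical is
reductive, hence so is `m`. -/
structure IsLeviFactor {𝔤 : Type*} [LieRing 𝔤] [LieAlgebra ℂ 𝔤]
    (q m : LieSubalgebra ℂ 𝔤) : Prop where
  disjoint : Disjoint m.toSubmodule (nilradicalSubmodule q)
  sup_eq : m.toSubmodule ⊔ nilradicalSubmodule q = q.toSubmodule

/-- `𝔫̄`: the span of the root vectors `e_{-φ}`, for `φ` running over the roots whose root space lies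
in the nilradical `𝔫` of `q`. -/
def oppositeNilradical {𝔤 : Type*} [LieRing 𝔤] [LieAlgebra ℂ 𝔤] [FiniteDimensional ℂ 𝔤]
    (H : LieSubalgebra ℂ 𝔤) [H.IsCartanSubalgebra] (q : LieSubalgebra ℂ 𝔤) : Submodule ℂ 𝔤 :=
  Submodule.span ℂ {x | ∃ φ ∈ H.root,
    (LieAlgebra.rootSpace H φ).toSubmodule ≤ nilradicalSubmodule q ∧
      x ∈ LieAlgebra.rootSpace H (-φ : H → ℂ)}

/-- For `ν` in the dual of the center `𝔱` of `m`, the weight space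
`𝔤_ν = {z | [x, z] = ν(x) z for all x ∈ 𝔱}`, as an `m`-submodule of `𝔤`. -/
def tRootSpace {𝔤 : Type*} [LieRing 𝔤] [LieAlgebra ℂ 𝔤] (m : LieSubalgebra ℂ 𝔤)
    (ν : Module.Dual ℂ (LieAlgebra.center ℂ m)) : LieSubmodule ℂ m 𝔤 where
  carrier := {z | ∀ x : LieAlgebra.center ℂ m, ⁅((x : m) : 𝔤), z⁆ = ν x • z}
  add_mem' := by
    intro a b ha hb x
    rw [lie_add, ha x, hb x, smul_add]
  zero_mem' := by
    intro x
    simp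
  smul_mem' := by
    intro c a ha x
    rw [lie_smul, ha x, smul_comm]
  lie_mem := by
    intro y z hz x
    have hxy : ⁅((x : m) : 𝔤), (y : 𝔤)⁆ = 0 := by
      have h := (LieModule.mem_maxTrivSubmodule (R := ℂ) (L := m) (M := m) (x : m)).mp x.2 y
      have h' : ⁅(y : 𝔤), ((x : m) : 𝔤)⁆ = 0 := by
        simpa using congrArg (Subtype.val : m → 𝔤) h
      rw [← lie_skew, h', neg_zero]
    change ⁅((x : m) : 𝔤), ⁅(y : 𝔤), z⁆⁆ = ν x • ⁅(y : 𝔤), z⁆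
    rw [leibniz_lie, hxy, zero_lie, zero_add, hz x, lie_smul]

/-- The set `R` of `𝔱`-roots: the nonzero `ν` in the dual of `𝔱 = cent m` with `𝔤_ν ≠ 0`. -/
def tRoots {𝔤 : Type*} [LieRing 𝔤] [LieAlgebra ℂ 𝔤] (m : LieSubalgebra ℂ 𝔤) :
    Set (Module.Dual ℂ (LieAlgebra.center ℂ m)) :=
  {ν | ν ≠ 0 ∧ tRootSpace m ν ≠ ⊥}

/-- `[𝔤_ν, 𝔤_{-ν}]`, the span of all brackets, viewed inside `m` (as an ideal of `m`). -/
def tRootBracket {𝔤 : Type*} [LieRing 𝔤] [LieAlgebra ℂ 𝔤] (m : LieSubalgebra ℂ 𝔤)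
    (ν : Module.Dual ℂ (LieAlgebra.center ℂ m)) : LieIdeal ℂ m where
  __ := (Submodule.span ℂ
    {x : 𝔤 | ∃ y ∈ tRootSpace m ν, ∃ z ∈ tRootSpace m (-ν), ⁅y, z⁆ = x}).comap
      m.toSubmodule.subtype
  lie_mem := by
    intro w x hx
    change ((⁅w, x⁆ : m) : 𝔤) ∈ Submodule.span ℂ
      {x : 𝔤 | ∃ y ∈ tRootSpace m ν, ∃ z ∈ tRootSpace m (-ν), ⁅y, z⁆ = x}
    change (x : 𝔤) ∈ Submodule.span ℂ
      {x : 𝔤 | ∃ y ∈ tRootSpace m ν, ∃ z ∈ tRootSpace m (-ν), ⁅y, z⁆ = x} at hx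
    rw [LieSubalgebra.coe_bracket]
    generalize (x : 𝔤) = v at hx
    induction hx using Submodule.span_induction with
    | mem u hu =>
      obtain ⟨y, hy, z, hz, rfl⟩ := hu
      rw [leibniz_lie]
      refine add_mem (Submodule.subset_span ⟨⁅(w : 𝔤), y⁆, ?_, z, hz, rfl⟩)
        (Submodule.subset_span ⟨y, hy, ⁅(w : 𝔤), z⁆, ?_, rfl⟩)
      · exact (tRootSpace m ν).lie_mem (x := w) hy
      · exact (tRootSpace m (-ν)).lie_mem (x := w) hz
    | zero => simp
    | add u v _ _ h1 h2 => rw [lie_add]; exact add_mem h1 h2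
    | smul c u _ h => rw [lie_smul]; exact Submodule.smul_mem _ c h

/-- `𝔰 = [m, m]`, as an ideal of `m`. -/
def derivedIdeal {𝔤 : Type*} [LieRing 𝔤] [LieAlgebra ℂ 𝔤] (m : LieSubalgebra ℂ 𝔤) :
    LieIdeal ℂ m :=
  ⁅(⊤ : LieIdeal ℂ m), (⊤ : LieIdeal ℂ m)⁆

/-- A module is multiplicity-free if it is completely reducible and any two isomorphic irreducible
submodules of it coincide. -/
def IsMultiplicityFree (L M : Type*) [LieRing L] [LieAlgebra ℂ L] [AddCommGroup M] [Module ℂ M]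
    [LieRingModule L M] [LieModule ℂ L M] : Prop :=
  ComplementedLattice (LieSubmodule ℂ L M) ∧
    ∀ N N' : LieSubmodule ℂ L M, LieModule.IsIrreducible ℂ L N → LieModule.IsIrreducible ℂ L N' →
      Nonempty (N ≃ₗ⁅ℂ, L⁆ N') → N = N'

/-! Everything reduces to a grading. Let `D` be the roots `α` of `q` such that `-α` is not a root of
`q`, and let `h₀` be the sum of the coroots of `D`. Reflection arguments show that `f α = α h₀` is
an integer, positive on `D`, zero when `α` and `-α` both belong to `q`, and negative otherwise. So
`q` is the part of non-negative degree. Its nilradical is the part of positive degree, and a Levi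
factor containing `H` is the part of degree zero. As `h₀` is central in `m`, a root restricts to
zero on `𝔱` exactly when `f` vanishes on it. Hence `m = 𝔤_0`, and `𝔯` collects the root spaces with
`f ≠ 0`.

Irreducibility of `𝔤_ν` uses no highest weight theory. Let `X` be the set of roots of a non-zero
submodule and `σ` their sum. `X` is stable under the reflections in the roots of `m`, so `σ` is
orthogonal to those roots and its dual vector `v` lies in `𝔱`. All roots restricting to `ν`
therefore take the same value on `v`. If such a root `y` is missing from `X`, it makes no acute
angle with any member of `X`, since otherwise the difference would be a root of `m` leading from `X`
to `y`. The common value is thus at most zero, so `(σ, σ) ≤ 0` and `σ = 0`. Restricting `σ` to `𝔱`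
gives `|X| ν = 0`, which is absurd.

The smaller algebras are handled with the Killing form. The elements of `m` orthogonal to `[m, m]`
are central, and those orthogonal to `[𝔤_ν, 𝔤_{-ν}]` are the ones annihilating `𝔤_ν`. The form is
non-degenerate on both spaces, because a sum of brackets acting by a scalar on a stable subspace has
trace zero there. So `m` acts on `𝔤_ν` through either ideal up to scalars. Multiplicity-freeness
holds because `𝔱` acts on `𝔤_ν` by `ν`, which an isomorphism preserves. -/

namespace RootPairing

/-! ### Sets of roots stable under reflections, and sums of pairings -/

variable {ι R M N : Type*} [CommRing R] [CharZero R] [IsDomain R]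
  [AddCommGroup M] [Module R M] [AddCommGroup N] [Module R N]
  {P : RootPairing ι R M N} [P.IsCrystallographic]

/-- A set of roots closed under adding the root `i` contains the reflection in `i` of each of its
members making a non-acute angle with `i`. -/
lemma reflectionPerm_mem_of_pairingIn_nonpos [Finite ι] [P.IsReduced] {X : Set ι} {i j : ι}
    (hX : ∀ a ∈ X, ∀ b, P.root b = P.root a + P.root i → b ∈ X) (hj : j ∈ X)
    (hne : P.root j ≠ -P.root i) (h : P.pairingIn ℤ j i ≤ 0) :
    P.reflectionPerm i j ∈ X := by
  have hli : LinearIndependent R ![P.root i, P.root j] := by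
    by_contra hli
    rcases IsReduced.eq_or_eq_neg i j hli with h1 | h1
    · rw [P.root.injective h1] at h
      simp at h
    · exact hne (by rw [h1, neg_neg])
  -- The reflection of `j` is `j + n i`. The `i`-string through `j` extends at least `n` steps
  -- upwards, so it is reached inside `X` one step at a time.
  obtain ⟨n, hn⟩ : ∃ n : ℕ, P.pairingIn ℤ j i = -n := ⟨(-P.pairingIn ℤ j i).toNat, by lia⟩
  have hstring (k : ℕ) (hk : k ≤ n) : ∃ b ∈ X, P.root b = P.root j + k • P.root i := by
    induction k with
    | zero => exact ⟨j, hj, by simp⟩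
    | succ k ih =>
      obtain ⟨a, ha, ha'⟩ := ih (by lia)
      have hk' : k + 1 ≤ P.chainTopCoeff i j := by
        have := chainBotCoeff_sub_chainTopCoeff hli
        lia
      obtain ⟨b, hb⟩ := (P.root_add_nsmul_mem_range_iff_le_chainTopCoeff hli).mpr hk'
      exact ⟨b, hX a ha b (by rw [hb, ha', succ_nsmul, add_assoc]), hb⟩
  obtain ⟨b, hb, hb'⟩ := hstring n le_rfl
  convert hb
  apply P.root.injective
  rw [hb', root_reflectionPerm, reflection_apply_root, ← P.algebraMap_pairingIn ℤ, hn]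
  simp [Nat.cast_smul_eq_nsmul]

/-- The set of roots `X` is stable under the reflection in `i` if it is closed under adding and
subtracting the root `i`. -/
lemma reflectionPerm_mem [Finite ι] [P.IsReduced] {X : Set ι} {i j : ι}
    (hX : ∀ a ∈ X, ∀ b, P.root b = P.root a + P.root i → b ∈ X)
    (hX' : ∀ a ∈ X, ∀ b, P.root b = P.root a - P.root i → b ∈ X) (hj : j ∈ X)
    (hne : P.root j ≠ -P.root i) (hne' : P.root j ≠ P.root i) :
    P.reflectionPerm i j ∈ X := by
  rcases le_total (P.pairingIn ℤ j i) 0 with h | h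
  · exact reflectionPerm_mem_of_pairingIn_nonpos hX hj hne h
  · have key := reflectionPerm_mem_of_pairingIn_nonpos (P := P) (X := X)
      (i := P.reflectionPerm i i) (j := j)
      (fun a ha b hb ↦ hX' a ha b (by rw [hb, root_reflectionPerm, reflection_apply_self]; abel))
      hj (by simpa using hne') (by simpa using h)
    convert key using 1
    apply P.root.injective
    simp [root_reflectionPerm, reflection_apply, two_smul]

omit [IsDomain R] in
lemma pairingIn_reflectionPerm_right (i j : ι) :
    P.pairingIn ℤ i (P.reflectionPerm i j) = -P.pairingIn ℤ i j := by
  rw [pairingIn_reflectionPerm, pairingIn_reflectionPerm_self_left]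

omit [IsDomain R] in
lemma pairingIn_reflectionPerm_left (i j : ι) :
    P.pairingIn ℤ (P.reflectionPerm i j) i = -P.pairingIn ℤ j i := by
  rw [← pairingIn_reflectionPerm, pairingIn_reflectionPerm_self_right]

section sums

variable [Finite ι] [P.IsReduced] {X : Finset ι} {i : ι}

/-- The reflection in `i` permutes `X` and changes the sign of every term. -/
lemma sum_pairingIn_right_eq_zero
    (hX : ∀ a ∈ X, ∀ b, P.root b = P.root a + P.root i → b ∈ X)
    (hX' : ∀ a ∈ X, ∀ b, P.root b = P.root a - P.root i → b ∈ X)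
    (hne : ∀ a ∈ X, P.root a ≠ -P.root i) (hne' : ∀ a ∈ X, P.root a ≠ P.root i) :
    ∑ j ∈ X, P.pairingIn ℤ i j = 0 := by
  have h (j) (hj : j ∈ X) : P.reflectionPerm i j ∈ X :=
    reflectionPerm_mem (X := (X : Set ι)) hX hX' hj (hne j hj) (hne' j hj)
  have := Finset.sum_nbij' (s := X) (t := X) (f := fun j ↦ P.pairingIn ℤ i j)
    (g := fun j ↦ -P.pairingIn ℤ i j) (P.reflectionPerm i) (P.reflectionPerm i) h h
    (by simp) (by simp) (fun j _ ↦ by rw [pairingIn_reflectionPerm_right, neg_neg])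
  rw [Finset.sum_neg_distrib] at this
  lia

lemma sum_pairingIn_left_eq_zero
    (hX : ∀ a ∈ X, ∀ b, P.root b = P.root a + P.root i → b ∈ X)
    (hX' : ∀ a ∈ X, ∀ b, P.root b = P.root a - P.root i → b ∈ X)
    (hne : ∀ a ∈ X, P.root a ≠ -P.root i) (hne' : ∀ a ∈ X, P.root a ≠ P.root i) :
    ∑ j ∈ X, P.pairingIn ℤ j i = 0 := by
  have h (j) (hj : j ∈ X) : P.reflectionPerm i j ∈ X :=
    reflectionPerm_mem (X := (X : Set ι)) hX hX' hj (hne j hj) (hne' j hj)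
  have := Finset.sum_nbij' (s := X) (t := X) (f := fun j ↦ P.pairingIn ℤ j i)
    (g := fun j ↦ -P.pairingIn ℤ j i) (P.reflectionPerm i) (P.reflectionPerm i) h h
    (by simp) (by simp) (fun j _ ↦ by rw [pairingIn_reflectionPerm_left, neg_neg])
  rw [Finset.sum_neg_distrib] at this
  lia

/-- Terms whose reflection stays in `X` cancel. A root whose reflection leaves `X` must make an
acute angle with `i`, and `i` itself is such a root. -/
lemma sum_pairingIn_right_pos (hi : i ∈ X)
    (hX : ∀ a ∈ X, ∀ b, P.root b = P.root a + P.root i → b ∈ X)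
    (hne : ∀ a ∈ X, P.root a ≠ -P.root i) :
    0 < ∑ j ∈ X, P.pairingIn ℤ i j := by
  classical
  rw [← Finset.sum_filter_add_sum_filter_not X (fun j ↦ P.reflectionPerm i j ∈ X)]
  have h1 : ∑ j ∈ X with P.reflectionPerm i j ∈ X, P.pairingIn ℤ i j = 0 := by
    have := Finset.sum_nbij' (s := {j ∈ X | P.reflectionPerm i j ∈ X})
      (t := {j ∈ X | P.reflectionPerm i j ∈ X}) (f := fun j ↦ P.pairingIn ℤ i j)
      (g := fun j ↦ -P.pairingIn ℤ i j) (P.reflectionPerm i) (P.reflectionPerm i)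
      (by simp +contextual) (by simp +contextual) (by simp) (by simp)
      (fun j _ ↦ by rw [pairingIn_reflectionPerm_right, neg_neg])
    rw [Finset.sum_neg_distrib] at this
    lia
  rw [h1, zero_add]
  refine Finset.sum_pos (fun j hj ↦ ?_) ⟨i, ?_⟩
  · obtain ⟨hj, hj'⟩ := Finset.mem_filter.mp hj
    contrapose! hj'
    exact reflectionPerm_mem_of_pairingIn_nonpos (X := (X : Set ι)) hX hj (hne j hj)
      (not_lt.mp fun h ↦ hj'.not_gt ((P.zero_lt_pairingIn_iff' ℤ).mp h))
  · refine Finset.mem_filter.mpr ⟨hi, fun h ↦ hne _ h ?_⟩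
    simp [root_reflectionPerm]

end sums

omit [IsDomain R] in
/-- The coweight dual to the sum of the roots in `X`, for the canonical bilinear form. -/
lemma exists_coweight_of_finset [Finite ι] (X : Finset ι) :
    ∃ (v : N) (g : ι → ℤ), (∀ i, P.toLinearMap (P.root i) v = g i) ∧
      (∀ i, ∑ j ∈ X, P.pairingIn ℤ j i = 0 → g i = 0) ∧
      (∀ i, (∀ j ∈ X, P.pairingIn ℤ i j ≤ 0) → g i ≤ 0) ∧
      (∑ j ∈ X, g j ≤ 0 → ∀ i, ∑ j ∈ X, P.pairingIn ℤ j i = 0) := by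
  have := Fintype.ofFinite ι
  let B := P.posRootForm ℤ
  -- An integral copy of the canonical form, so that signs make sense although `R` is not ordered.
  let q (i j : ι) : ℤ := ∑ k, P.pairingIn ℤ i k * P.pairingIn ℤ j k
  have hq (i j : ι) : (q i j : R) = P.RootForm (P.root i) (P.root j) := by
    simp [q, rootForm_apply_apply, ← P.algebraMap_pairingIn ℤ, -algebraMap_pairingIn]
  have hq2 (i j : ι) : 2 * q i j = P.pairingIn ℤ i j * q j j := by
    have := B.two_mul_apply_root_root i j
    change 2 * P.RootForm (P.root i) (P.root j) =
      P.pairing i j * P.RootForm (P.root j) (P.root j) at this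
    rw [← hq, ← hq, ← P.algebraMap_pairingIn ℤ, eq_intCast] at this
    exact_mod_cast this
  have hqpos (j : ι) : 0 < q j j :=
    Finset.sum_pos' (fun k _ ↦ mul_self_nonneg _) ⟨j, by simp⟩
  have hqsymm (i j : ι) : q i j = q j i := by simp [q, mul_comm]
  refine ⟨P.Polarization (∑ j ∈ X, P.root j), fun i ↦ ∑ j ∈ X, q i j, fun i ↦ ?_, fun i hi ↦ ?_,
    fun i hi ↦ ?_, fun h i ↦ ?_⟩
  · rw [toLinearMap_apply_apply_Polarization]
    simp only [map_sum, LinearMap.sum_apply, Int.cast_sum, hq]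
    exact Finset.sum_congr rfl fun j _ ↦ (P.rootForm_symmetric.eq _ _)
  · have : 2 * ∑ j ∈ X, q i j = 0 := by
      rw [Finset.mul_sum, Finset.sum_congr rfl (fun j _ ↦ by rw [hqsymm i j, hq2 j i]),
        ← Finset.sum_mul, hi, zero_mul]
    lia
  · refine Finset.sum_nonpos fun j hj ↦ ?_
    have := hq2 i j
    nlinarith [hi j hj, hqpos j]
  · have hsq : ∑ k, (∑ j ∈ X, P.pairingIn ℤ j k) ^ 2 ≤ 0 := by
      refine le_of_eq_of_le ?_ h
      simp only [q, sq, Finset.sum_mul_sum]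
      rw [Finset.sum_comm]
      refine Finset.sum_congr rfl fun j _ ↦ ?_
      rw [Finset.sum_comm]
    have h0 := (Finset.sum_eq_zero_iff_of_nonneg (fun k _ ↦ sq_nonneg _)).mp
      (le_antisymm hsq (Finset.sum_nonneg fun k _ ↦ sq_nonneg _)) i (Finset.mem_univ i)
    exact pow_eq_zero_iff two_ne_zero |>.mp h0

end RootPairing

/-! ### Root vectors and decomposition into weight spaces -/

section RootSpaces

open LieAlgebra LieAlgebra.IsKilling LieModule Module

variable {K L : Type*} [Field K] [CharZero K] [LieRing L] [LieAlgebra K L]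
  [IsKilling K L] [FiniteDimensional K L]
  {H : LieSubalgebra K L} [H.IsCartanSubalgebra] [IsTriangularizable K H L]

lemma exists_smul_eq_of_mem_rootSpace {α : Weight K H L} (hα : α.IsNonZero) {x y : L}
    (hx : x ∈ rootSpace H α) (hy : y ∈ rootSpace H α) (hx0 : x ≠ 0) : ∃ c : K, c • x = y := by
  obtain ⟨c, hc⟩ := (finrank_eq_one_iff_of_nonzero' (⟨x, hx⟩ : rootSpace H α)
    (by simpa using hx0)).mp (finrank_rootSpace_eq_one α hα) ⟨y, hy⟩
  exact ⟨c, by simpa using congrArg Subtype.val hc⟩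

lemma rootSpace_le_of_mem {α : Weight K H L} (hα : α.IsNonZero) {W : Submodule K L} {x : L}
    (hx : x ∈ rootSpace H α) (hx0 : x ≠ 0) (hxW : x ∈ W) :
    (rootSpace H α).toSubmodule ≤ W := by
  intro y hy
  obtain ⟨c, rfl⟩ := exists_smul_eq_of_mem_rootSpace hα hx hy hx0
  exact W.smul_mem c hxW

/-- If the sum of two roots is a root then the brackets of their root vectors do not vanish. -/
lemma lie_ne_zero_of_add_eq_weight {α β γ : Weight K H L} (hα : α.IsNonZero) (hβ : β.IsNonZero)
    (hγ : (γ : H → K) = α + β) {x y : L} (hx : x ∈ rootSpace H α) (hy : y ∈ rootSpace H β)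
    (hx0 : x ≠ 0) (hy0 : y ≠ 0) : ⁅x, y⁆ ≠ 0 := by
  -- Start from the top of the `α`-string through `β`. With `n + 1` steps from `β` to the top, `f ^
  -- (n + 1) z` spans the root space of `β`, and `e` maps it to `(n + 1) (chainLength - n) f ^ n z`,
  -- which is non-zero.
  obtain ⟨z, hz, hz0⟩ := (chainTop α β).exists_ne_zero
  obtain ⟨h, e, f, isSl2, he, hf⟩ := exists_isSl2Triple_of_weight_isNonZero hα
  obtain rfl := isSl2.h_eq_coroot hα he hf
  have prim : isSl2.HasPrimitiveVectorWith z (chainLength α β : K) :=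
    have := lie_mem_genWeightSpace_of_mem_genWeightSpace he hz
    ⟨hz0, (chainLength_smul _ _ hz).symm, by rwa [genWeightSpace_add_chainTop _ _ hα] at this⟩
  obtain ⟨n, hn⟩ : ∃ n, chainTopCoeff α β = n + 1 := by
    refine Nat.exists_eq_add_one.mpr (Nat.pos_of_ne_zero fun h0 ↦ Weight.genWeightSpace_ne_bot L γ ?_)
    have := genWeightSpace_chainTopCoeff_add_one_nsmul_add α β hα
    rw [h0, zero_add, one_smul] at this
    rwa [hγ]
  have hle := chainTopCoeff_le_chainLength α β
  have hmem : ((toEnd K L L f) ^ (n + 1)) z ∈ rootSpace H β := by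
    convert toEnd_pow_apply_mem hf hz (n + 1) using 2
    rw [coe_chainTop', hn, smul_neg, neg_add_cancel_left]
  obtain ⟨c, rfl⟩ := exists_smul_eq_of_mem_rootSpace hα hx he hx0
  obtain ⟨d, hd⟩ := exists_smul_eq_of_mem_rootSpace hβ hy hmem hy0
  have key := prim.lie_e_pow_succ_toEnd_f n
  intro h0
  rw [← hd, lie_smul, smul_lie, h0, smul_zero, smul_zero, eq_comm, smul_eq_zero] at key
  refine key.elim (fun h1 ↦ ?_) (prim.pow_toEnd_f_ne_zero_of_eq_nat rfl (by lia))
  rcases mul_eq_zero.mp h1 with h2 | h2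
  · exact Nat.cast_add_one_ne_zero n h2
  · have := Nat.cast_injective (R := K) (sub_eq_zero.mp h2)
    lia

/-- A subspace containing the brackets of two root spaces contains the root space of the sum. -/
lemma rootSpace_le_of_lie_mem {α β γ : Weight K H L} (hα : α.IsNonZero) (hβ : β.IsNonZero)
    (hγ0 : γ.IsNonZero) (hγ : (γ : H → K) = α + β) {W : Submodule K L}
    (h : ∀ x ∈ rootSpace H α, ∀ y ∈ rootSpace H β, ⁅x, y⁆ ∈ W) :
    (rootSpace H γ).toSubmodule ≤ W := by
  obtain ⟨x, hx, hx0⟩ := α.exists_ne_zero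
  obtain ⟨y, hy, hy0⟩ := β.exists_ne_zero
  refine rootSpace_le_of_mem hγ0 (x := ⁅x, y⁆) ?_
    (lie_ne_zero_of_add_eq_weight hα hβ hγ hx hy hx0 hy0) (h x hx y hy)
  rw [hγ]
  exact lie_mem_genWeightSpace_of_mem_genWeightSpace hx hy

omit [CharZero K] [IsKilling K L] [IsTriangularizable K H L] in
lemma mem_cartan_of_mem_rootSpace_zero {χ : Weight K H L} (hχ : χ.IsZero) {z : L}
    (hz : z ∈ rootSpace H χ) : z ∈ H := by
  rw [hχ.eq] at hz
  have hz' : z ∈ (rootSpace H (0 : H → K)).toSubmodule := hz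
  rwa [rootSpace_zero_eq] at hz'

omit [CharZero K] [IsKilling K L] in
/-- A subspace stable under the Cartan subalgebra lies in a given subspace as soon as its weight
vectors do. -/
lemma le_of_forall_mem_genWeightSpace {N W : Submodule K L} (hN : ∀ h : H, ∀ x ∈ N, ⁅h, x⁆ ∈ N)
    (hW : ∀ χ : Weight K H L, ∀ z ∈ N, z ∈ rootSpace H χ → z ∈ W) : N ≤ W := by
  let N' : LieSubmodule K H L := { N with lie_mem := fun {h x} hx ↦ hN h x hx }
  have h1 : N'.toSubmodule ≤ W := by
    rw [eq_iSup_inf_genWeightSpace K H L N', LieSubmodule.iSup_toSubmodule]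
    exact iSup_le fun χ z hz ↦ hW χ z hz.1 hz.2
  exact h1

omit [CharZero K] [IsKilling K L] [FiniteDimensional K L] [IsTriangularizable K H L] in
/-- A weight vector in a sum of weight spaces lies in one of them. -/
lemma eq_zero_of_mem_rootSpace_of_mem_iSup {χ : Weight K H L} {T : Set (Weight K H L)} {z : L}
    (hz : z ∈ rootSpace H χ) (hT : χ ∉ T)
    (hz' : z ∈ (⨆ ψ ∈ T, (rootSpace H (ψ : H → K)).toSubmodule : Submodule K L)) : z = 0 := by
  have hind := LieSubmodule.iSupIndep_toSubmodule.mpr (iSupIndep_genWeightSpace' K H L)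
  have hle : (⨆ ψ ∈ T, (rootSpace H (ψ : H → K)).toSubmodule : Submodule K L) ≤
      ⨆ (ψ : Weight K H L) (_ : ψ ≠ χ), (rootSpace H (ψ : H → K)).toSubmodule :=
    iSup₂_le fun ψ hψ ↦ le_iSup₂_of_le ψ (fun h ↦ hT (h ▸ hψ)) le_rfl
  exact Submodule.disjoint_def.mp (hind χ) z hz (hle hz')

end RootSpaces

/-! ### The integral grading attached to a parabolic subalgebra -/

section Parabolic

open LieAlgebra LieAlgebra.IsKilling LieModule Module

variable {𝔤 : Type*} [LieRing 𝔤] [LieAlgebra ℂ 𝔤] [FiniteDimensional ℂ 𝔤]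
  [LieAlgebra.IsSemisimple ℂ 𝔤] {H : LieSubalgebra ℂ 𝔤} [H.IsCartanSubalgebra]

lemma coe_eq_add_of_root_eq_add {a b c : H.root}
    (h : (rootSystem H).root c = (rootSystem H).root a + (rootSystem H).root b) :
    (c.1 : H → ℂ) = a.1 + b.1 := by
  ext x
  simpa using congrArg (fun l : Dual ℂ H ↦ l x) h

lemma cartan_le_borelOfBase (b : (rootSystem H).Base) : H ≤ borelOfBase H b :=
  fun _ hx ↦ Submodule.subset_span (Or.inl hx)

lemma rootSpace_le_borelOfBase (b : (rootSystem H).Base) {i : H.root} (hi : b.IsPos i) :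
    (rootSpace H i.1).toSubmodule ≤ (borelOfBase H b).toSubmodule :=
  fun _ hx ↦ Submodule.subset_span (Or.inr ⟨i, hi, hx⟩)

/-- A subalgebra containing a Borel subalgebra is the non-negative part of the grading defined by an
element of the Cartan subalgebra at which all roots take integral values. -/
lemma exists_grading_of_borelOfBase_le {b : (rootSystem H).Base} {q : LieSubalgebra ℂ 𝔤}
    (hbq : borelOfBase H b ≤ q) :
    ∃ (h₀ : H) (f : H.root → ℤ), (∀ α, α.1 h₀ = f α) ∧
      ∀ α, (rootSpace H α.1).toSubmodule ≤ q.toSubmodule ↔ 0 ≤ f α := by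
  classical
  let P := rootSystem H
  let X : Set H.root := {α | (rootSpace H α.1).toSubmodule ≤ q.toSubmodule}
  let neg (i : H.root) : H.root := P.reflectionPerm i i
  have hneg (i) : P.root (neg i) = -P.root i := by simp [neg, RootPairing.root_reflectionPerm]
  have hnegneg (i) : neg (neg i) = i := P.root.injective (by rw [hneg, hneg, neg_neg])
  have hadd {a b c : H.root} (ha : a ∈ X) (hb : b ∈ X) (hc : P.root c = P.root a + P.root b) :
      c ∈ X :=
    rootSpace_le_of_lie_mem (H.isNonZero_coe_root a) (H.isNonZero_coe_root b)
      (H.isNonZero_coe_root c) (coe_eq_add_of_root_eq_add hc)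
      fun x hx y hy ↦ q.lie_mem (ha hx) (hb hy)
  have htotal (i) : i ∈ X ∨ neg i ∈ X :=
    (RootPairing.Base.IsPos.or_neg b i).imp
      (fun h ↦ (rootSpace_le_borelOfBase b h).trans hbq)
      (fun h ↦ (rootSpace_le_borelOfBase b h).trans hbq)
  -- These will be the roots of the nilradical. Adding a root of `q` does not lead out of `D`.
  let D : Finset H.root := {i | i ∈ X ∧ neg i ∉ X}
  have hD {i} : i ∈ D ↔ i ∈ X ∧ neg i ∉ X := by simp [D]
  have hDadd {i} (hi : i ∈ X) : ∀ a ∈ D, ∀ b, P.root b = P.root a + P.root i → b ∈ D := by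
    intro a ha b hb
    rw [hD] at ha ⊢
    refine ⟨hadd ha.1 hi hb, fun h ↦ ha.2 (hadd h hi ?_)⟩
    rw [hneg, hneg, hb]
    abel
  have hne {i} (hi : i ∈ X) : ∀ a ∈ D, P.root a ≠ -P.root i := by
    intro a ha h
    rw [← hneg] at h
    obtain rfl := P.root.injective h
    exact (hD.mp ha).2 (by rwa [hnegneg])
  let f (i : H.root) : ℤ := ∑ j ∈ D, P.pairingIn ℤ i j
  have hpos {i} (hi : i ∈ D) : 0 < f i :=
    RootPairing.sum_pairingIn_right_pos hi (hDadd (hD.mp hi).1) (hne (hD.mp hi).1)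
  have hfneg (i) : f (neg i) = -f i := by simp [f, neg]
  refine ⟨∑ j ∈ D, P.coroot j, f, fun α ↦ ?_, fun α ↦ ⟨fun h ↦ ?_, fun h ↦ ?_⟩⟩
  · rw [map_sum]
    simp only [f, Int.cast_sum]
    refine Finset.sum_congr rfl fun j _ ↦ ?_
    have := P.algebraMap_pairingIn ℤ α j
    rw [eq_intCast] at this
    rw [this]
    rfl
  · by_cases h' : neg α ∈ X
    · refine le_of_eq (Eq.symm ?_)
      refine RootPairing.sum_pairingIn_right_eq_zero (hDadd h) (fun a ha b hb ↦ ?_) (hne h) ?_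
      · exact hDadd h' a ha b (by rw [hb, hneg, sub_eq_add_neg])
      · intro a ha
        simpa [hneg] using hne h' a ha
    · exact (hpos (hD.mpr ⟨h, h'⟩)).le
  · by_contra h'
    have h1 : neg α ∈ X := (htotal α).resolve_left h'
    have := hpos (hD.mpr ⟨h1, by rwa [hnegneg]⟩)
    rw [hfneg] at this
    lia

/-- The part of degree at least `k` of the grading defined by `h₀`. -/
def gradedPartGE (h₀ : 𝔤) (k : ℤ) : Submodule ℂ 𝔤 :=
  ⨆ n : {n : ℤ // k ≤ n}, (ad ℂ 𝔤 h₀).eigenspace (n : ℤ)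

omit [FiniteDimensional ℂ 𝔤] [IsSemisimple ℂ 𝔤] in
lemma lie_mem_gradedPartGE {h₀ x y : 𝔤} {j k : ℤ} (hx : x ∈ gradedPartGE h₀ j)
    (hy : y ∈ gradedPartGE h₀ k) : ⁅x, y⁆ ∈ gradedPartGE h₀ (j + k) := by
  unfold gradedPartGE at hx hy
  induction hx using Submodule.iSup_induction' with
  | zero => simp
  | add u v _ _ h1 h2 => rw [add_lie]; exact add_mem h1 h2
  | mem n u hu =>
    induction hy using Submodule.iSup_induction' with
    | zero => simp
    | add u v _ _ h1 h2 => rw [lie_add]; exact add_mem h1 h2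
    | mem l v hv =>
      refine Submodule.mem_iSup_of_mem (⟨n + l, add_le_add n.2 l.2⟩ : {n : ℤ // j + k ≤ n}) ?_
      rw [Module.End.mem_eigenspace_iff, ad_apply] at hu hv ⊢
      rw [leibniz_lie, hu, hv, smul_lie, lie_smul, ← add_smul, Int.cast_add]

omit [FiniteDimensional ℂ 𝔤] [IsSemisimple ℂ 𝔤] in
lemma gradedPartGE_antitone (h₀ : 𝔤) : Antitone (gradedPartGE h₀) := fun _ _ hjk ↦
  iSup_le fun n ↦ le_iSup_of_le (⟨n, hjk.trans n.2⟩ : {n : ℤ // _ ≤ n}) le_rfl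

omit [IsSemisimple ℂ 𝔤] in
lemma exists_gradedPartGE_eq_bot (h₀ : 𝔤) : ∃ k : ℕ, gradedPartGE h₀ k = ⊥ := by
  have hfin : {n : ℤ | (ad ℂ 𝔤 h₀).HasEigenvalue (n : ℂ)}.Finite :=
    (Module.End.finite_hasEigenvalue (ad ℂ 𝔤 h₀)).preimage (Int.cast_injective.injOn)
  obtain ⟨k, hk⟩ := hfin.bddAbove
  refine ⟨(k + 1).toNat, iSup_eq_bot.mpr fun n ↦ ?_⟩
  by_contra h
  have h1 : (n : ℤ) ≤ k := hk (Module.End.hasEigenvalue_iff.mpr h)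
  have h2 := n.2
  lia

section

variable {h₀ : H} {f : H.root → ℤ}

lemma rootSpace_le_gradedPartGE (hf : ∀ α : H.root, α.1 h₀ = f α) {α : H.root} {k : ℤ} (hk : k ≤ f α) :
    (rootSpace H α.1).toSubmodule ≤ gradedPartGE (h₀ : 𝔤) k := fun z hz ↦ by
  refine Submodule.mem_iSup_of_mem (⟨f α, hk⟩ : {n : ℤ // k ≤ n}) ?_
  rw [Module.End.mem_eigenspace_iff, ad_apply]
  have := lie_eq_smul_of_mem_rootSpace hz h₀
  rw [hf] at this
  exact this

lemma gradedPartGE_le_iSup_rootSpace (hf : ∀ α : H.root, α.1 h₀ = f α) {k : ℤ} (hk : 0 < k) :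
    gradedPartGE (h₀ : 𝔤) k ≤
      ⨆ χ ∈ {χ : Weight ℂ H 𝔤 | ∃ α : H.root, χ = α.1 ∧ k ≤ f α},
        (rootSpace H (χ : H → ℂ)).toSubmodule := by
  refine iSup_le fun n ↦ le_of_forall_mem_genWeightSpace (H := H) (fun h x hx ↦ ?_)
    fun χ z hz hzχ ↦ ?_
  · have hcomm : ⁅(h₀ : 𝔤), (h : 𝔤)⁆ = 0 := congrArg Subtype.val (trivial_lie_zero H H h₀ h)
    rw [Module.End.mem_eigenspace_iff, ad_apply] at hx ⊢
    rw [LieSubalgebra.coe_bracket_of_module, leibniz_lie, hx, hcomm, zero_lie, zero_add, lie_smul]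
  · by_cases hz0 : z = 0
    · simp [hz0]
    have h1 : χ h₀ = (n : ℤ) := by
      have h2 := lie_eq_smul_of_mem_rootSpace hzχ h₀
      rw [Module.End.mem_eigenspace_iff, ad_apply] at hz
      exact smul_left_injective ℂ hz0 (h2.symm.trans hz)
    have hχ : χ.IsNonZero := fun h0 ↦ by
      rw [h0.eq, Pi.zero_apply, eq_comm, Int.cast_eq_zero] at h1
      have := n.2
      lia
    have h2 : (f ⟨χ, by simpa using hχ⟩) = (n : ℤ) := by
      have := hf ⟨χ, by simpa using hχ⟩
      rw [h1] at this
      exact_mod_cast this.symm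
    exact Submodule.mem_iSup_of_mem χ (Submodule.mem_iSup_of_mem
      ⟨⟨χ, by simpa using hχ⟩, rfl, h2 ▸ n.2⟩ hzχ)

end

end Parabolic

/-! ### Nilradical and Levi factor in terms of the grading -/

section Nilradical

open LieAlgebra LieAlgebra.IsKilling LieModule Module

section

variable {K L : Type*} [Field K] [LieRing L] [LieAlgebra K L]

/-- In a nilpotent ideal, no element has a non-zero eigenvalue on the ideal. -/
lemma eq_zero_of_lie_eq_smul_of_isNilpotent {q : LieSubalgebra K L} {I : LieIdeal K q}
    (hI : LieRing.IsNilpotent I) {x e : q} (hx : x ∈ I) (he : e ∈ I) {c : K} (hc : c ≠ 0)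
    (h : ⁅x, e⁆ = c • e) : e = 0 := by
  have hpow (n : ℕ) : ((toEnd K I I ⟨x, hx⟩) ^ n) ⟨e, he⟩ = c ^ n • (⟨e, he⟩ : I) := by
    induction n with
    | zero => simp
    | succ n ih =>
      have h1 : ⁅(⟨x, hx⟩ : I), (⟨e, he⟩ : I)⁆ = c • (⟨e, he⟩ : I) := Subtype.ext h
      rw [pow_succ', Module.End.mul_apply, ih, map_smul, toEnd_apply_apply, h1, smul_smul,
        pow_succ]
  obtain ⟨n, hn⟩ := LieModule.isNilpotent_toEnd_of_isNilpotent K I I ⟨x, hx⟩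
  have h2 := hpow n
  rw [hn, LinearMap.zero_apply, eq_comm, smul_eq_zero] at h2
  exact congrArg Subtype.val (h2.resolve_left (pow_ne_zero n hc))

end

variable {𝔤 : Type*} [LieRing 𝔤] [LieAlgebra ℂ 𝔤] [FiniteDimensional ℂ 𝔤]
  [LieAlgebra.IsSemisimple ℂ 𝔤] {H : LieSubalgebra ℂ 𝔤} [H.IsCartanSubalgebra]
  {q m : LieSubalgebra ℂ 𝔤} {h₀ : H} {f : H.root → ℤ}

/-- The negative of a root, as a root. -/
noncomputable def negRoot (α : H.root) : H.root :=
  ⟨-α.1, by simpa using H.isNonZero_coe_root α⟩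

lemma apply_negRoot (hf : ∀ α : H.root, α.1 h₀ = f α) (α : H.root) : f (negRoot α) = -f α := by
  have h := hf (negRoot α)
  change -(α.1 h₀) = _ at h
  rw [hf] at h
  exact_mod_cast h.symm

lemma le_gradedPartGE_zero (hf : ∀ α : H.root, α.1 h₀ = f α) (hHq : H ≤ q)
    (hq : ∀ α : H.root, (rootSpace H α.1).toSubmodule ≤ q.toSubmodule ↔ 0 ≤ f α) :
    q.toSubmodule ≤ gradedPartGE (h₀ : 𝔤) 0 := by
  refine le_of_forall_mem_genWeightSpace (H := H) (fun h x hx ↦ q.lie_mem (hHq h.2) hx)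
    fun χ z hz hzχ ↦ ?_
  by_cases hχ : χ.IsZero
  · refine Submodule.mem_iSup_of_mem (⟨0, le_rfl⟩ : {n : ℤ // 0 ≤ n}) ?_
    rw [Module.End.mem_eigenspace_iff, ad_apply]
    have := lie_eq_smul_of_mem_rootSpace hzχ h₀
    rw [hχ.eq] at this
    simpa using this
  · by_cases hz0 : z = 0
    · simp [hz0]
    exact rootSpace_le_gradedPartGE (α := ⟨χ, by simpa using hχ⟩) hf
      ((hq _).mp (rootSpace_le_of_mem hχ hzχ hz0 hz)) hzχ

lemma gradedPartGE_one_le (hf : ∀ α : H.root, α.1 h₀ = f α)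
    (hq : ∀ α : H.root, (rootSpace H α.1).toSubmodule ≤ q.toSubmodule ↔ 0 ≤ f α) :
    gradedPartGE (h₀ : 𝔤) 1 ≤ q.toSubmodule := by
  refine (gradedPartGE_le_iSup_rootSpace hf one_pos).trans (iSup₂_le ?_)
  rintro _ ⟨α, rfl, hα⟩
  exact (hq α).mpr (by lia)

/-- The part of positive degree of `q`, as an ideal. -/
noncomputable def positiveIdeal (hf : ∀ α : H.root, α.1 h₀ = f α) (hHq : H ≤ q)
    (hq : ∀ α : H.root, (rootSpace H α.1).toSubmodule ≤ q.toSubmodule ↔ 0 ≤ f α) : LieIdeal ℂ q where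
  __ := (gradedPartGE (h₀ : 𝔤) 1).comap q.toSubmodule.subtype
  lie_mem {x y} hy := by
    simpa using lie_mem_gradedPartGE (j := 0) (k := 1) (le_gradedPartGE_zero hf hHq hq x.2) hy

/-- Each bracket raises the degree by at least one, and only finitely many degrees occur. The lower
central series starts at index `0` in degree `1`, hence the bound `1 + k`. -/
lemma isNilpotent_positiveIdeal (hf : ∀ α : H.root, α.1 h₀ = f α) (hHq : H ≤ q)
    (hq : ∀ α : H.root, (rootSpace H α.1).toSubmodule ≤ q.toSubmodule ↔ 0 ≤ f α) :
    LieRing.IsNilpotent (positiveIdeal hf hHq hq) := by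
  let I : LieIdeal ℂ q := positiveIdeal hf hHq hq
  have hlcs (k : ℕ) : ∀ x ∈ lowerCentralSeries ℂ I I k, (x : 𝔤) ∈ gradedPartGE (h₀ : 𝔤) (1 + k) := by
    induction k with
    | zero =>
      intro x _
      rw [Nat.cast_zero, add_zero]
      exact x.2
    | succ k ih =>
      let J : LieSubmodule ℂ I I :=
        { (gradedPartGE (h₀ : 𝔤) (1 + (k + 1))).comap
            (q.toSubmodule.subtype ∘ₗ I.toSubmodule.subtype) with
          lie_mem := fun {x y} hy ↦ gradedPartGE_antitone _ (by lia)
            (lie_mem_gradedPartGE (j := 1) x.2 hy) }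
      have hJ : lowerCentralSeries ℂ I I (k + 1) ≤ J := by
        rw [LieModule.lowerCentralSeries_succ, LieSubmodule.lie_le_iff]
        intro x _ y hy
        change _ ∈ gradedPartGE (h₀ : 𝔤) (1 + (k + 1))
        rw [add_comm (k : ℤ) 1]
        exact lie_mem_gradedPartGE (j := 1) x.2 (ih y hy)
      intro x hx
      rw [Nat.cast_succ]
      exact hJ hx
  obtain ⟨k, hk⟩ := exists_gradedPartGE_eq_bot (h₀ : 𝔤)
  refine (LieModule.isNilpotent_iff ℂ I I).mpr ⟨k, (LieSubmodule.eq_bot_iff _).mpr fun x hx ↦ ?_⟩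
  have h1 := gradedPartGE_antitone (h₀ : 𝔤) (show (k : ℤ) ≤ 1 + k by lia) (hlcs k x hx)
  rw [hk, Submodule.mem_bot] at h1
  exact Subtype.ext (Subtype.ext h1)

lemma eq_zero_of_forall_root_apply_eq_zero {h : H} (hh : ∀ α : H.root, α.1 h = 0) : h = 0 := by
  have h1 : h ∈ ⨅ χ : Weight ℂ H 𝔤, χ.ker := by
    refine (Submodule.mem_iInf _).mpr fun χ ↦ ?_
    by_cases hχ : χ.IsZero
    · simp [hχ.eq]
    · exact hh ⟨χ, by simpa using hχ⟩
  rwa [iInf_ker_weight_eq_bot, Submodule.mem_bot] at h1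

lemma le_positiveIdeal_of_isNilpotent (hf : ∀ α : H.root, α.1 h₀ = f α) (hHq : H ≤ q)
    (hq : ∀ α : H.root, (rootSpace H α.1).toSubmodule ≤ q.toSubmodule ↔ 0 ≤ f α) {I : LieIdeal ℂ q}
    (hI : LieRing.IsNilpotent I) : I ≤ positiveIdeal hf hHq hq := by
  -- An eigenvector `e` in `q` equals `c⁻¹ ⁅x, e⁆`, so it already lies in the ideal `I`, where
  -- nilpotency rules it out.
  have key {x e : 𝔤} {c : ℂ} (hx : x ∈ I.toSubmodule.map q.toSubmodule.subtype) (heq : e ∈ q)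
      (hc : c ≠ 0) (h : ⁅x, e⁆ = c • e) : e = 0 := by
    obtain ⟨x, hx, rfl⟩ : ∃ y : q, y ∈ I ∧ (y : 𝔤) = x := hx
    have h1 : ⁅x, (⟨e, heq⟩ : q)⁆ = c • ⟨e, heq⟩ := Subtype.ext h
    have he : (⟨e, heq⟩ : q) ∈ I := by
      have h2 : (⟨e, heq⟩ : q) = c⁻¹ • ⁅x, (⟨e, heq⟩ : q)⁆ := by
        rw [h1, smul_smul, inv_mul_cancel₀ hc, one_smul]
      rw [h2]
      exact I.smul_mem _ (lie_mem_left ℂ q I x _ hx)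
    exact congrArg Subtype.val (eq_zero_of_lie_eq_smul_of_isNilpotent hI hx he hc h1)
  have hle : I.toSubmodule.map q.toSubmodule.subtype ≤ gradedPartGE (h₀ : 𝔤) 1 := by
    refine le_of_forall_mem_genWeightSpace (H := H) ?_ fun χ z hz hzχ ↦ ?_
    · rintro h _ ⟨x, hx, rfl⟩
      exact ⟨⁅(⟨h, hHq h.2⟩ : q), x⁆, I.lie_mem hx, rfl⟩
    by_cases hχ : χ.IsZero
    · have hzH := mem_cartan_of_mem_rootSpace_zero hχ hzχ
      have hroot {α : H.root} (hα : 0 ≤ f α) : α.1 ⟨z, hzH⟩ = 0 := by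
        by_contra hne
        obtain ⟨e, he, he0⟩ := α.1.exists_ne_zero
        exact he0 (key hz ((hq α).mpr hα he) hne
          (lie_eq_smul_of_mem_rootSpace he ⟨z, hzH⟩))
      have h0 : (⟨z, hzH⟩ : H) = 0 := eq_zero_of_forall_root_apply_eq_zero fun α ↦ by
        rcases le_total 0 (f α) with h | h
        · exact hroot h
        · have h1 := hroot (α := negRoot α) (by rw [apply_negRoot hf]; lia)
          exact neg_eq_zero.mp h1
      rw [show z = 0 from congrArg Subtype.val h0]
      exact zero_mem _
    · by_cases hz0 : z = 0
      · simp [hz0]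
      let α : H.root := ⟨χ, by simpa using hχ⟩
      have hIα : (rootSpace H α.1).toSubmodule ≤ I.toSubmodule.map q.toSubmodule.subtype :=
        rootSpace_le_of_mem hχ hzχ hz0 hz
      have hIq : I.toSubmodule.map q.toSubmodule.subtype ≤ q.toSubmodule :=
        Submodule.map_subtype_le _ _
      rcases ((hq α).mp (hIα.trans hIq)).lt_or_eq with h | h
      · exact rootSpace_le_gradedPartGE (α := α) hf (by lia) hzχ
      -- In degree zero `-α` is also a root of `q`, so `I` contains `h' = ⁅e, g⁆`, which has
      -- eigenvalue `2` on `e`.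
      · obtain ⟨h', e, g, ht, he, hg⟩ := exists_isSl2Triple_of_weight_isNonZero hχ
        have hgq : g ∈ q := (hq (negRoot α)).mpr (by rw [apply_negRoot hf]; lia) hg
        obtain ⟨e', he', rfl⟩ : ∃ y : q, y ∈ I ∧ (y : 𝔤) = e := hIα he
        refine absurd (key (x := h') (c := 2) ?_ e'.2 two_ne_zero (ht.lie_h_e_smul ℂ)) ht.e_ne_zero
        exact ⟨⁅e', (⟨g, hgq⟩ : q)⁆, lie_mem_left ℂ q I e' _ he', ht.lie_e_f⟩
  exact fun x hx ↦ hle ⟨x, hx, rfl⟩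

lemma nilradicalSubmodule_eq_gradedPartGE (hf : ∀ α : H.root, α.1 h₀ = f α) (hHq : H ≤ q)
    (hq : ∀ α : H.root, (rootSpace H α.1).toSubmodule ≤ q.toSubmodule ↔ 0 ≤ f α) :
    nilradicalSubmodule q = gradedPartGE (h₀ : 𝔤) 1 := by
  have h1 : sSup {I : LieIdeal ℂ q | LieRing.IsNilpotent I} =
      positiveIdeal hf hHq hq :=
    le_antisymm (sSup_le fun I hI ↦ le_positiveIdeal_of_isNilpotent hf hHq hq hI)
      (le_sSup (isNilpotent_positiveIdeal hf hHq hq))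
  rw [nilradicalSubmodule, h1]
  change ((gradedPartGE (h₀ : 𝔤) 1).comap q.toSubmodule.subtype).map _ = _
  rw [Submodule.map_comap_subtype]
  exact inf_eq_right.mpr (gradedPartGE_one_le hf hq)

/-- The root spaces in a Levi factor are those of degree zero. -/
lemma rootSpace_le_iff_of_isLeviFactor (hf : ∀ α : H.root, α.1 h₀ = f α) (hHq : H ≤ q)
    (hq : ∀ α : H.root, (rootSpace H α.1).toSubmodule ≤ q.toSubmodule ↔ 0 ≤ f α)
    (hm : IsLeviFactor q m) (hHm : H ≤ m) (α : H.root) :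
    (rootSpace H α.1).toSubmodule ≤ m.toSubmodule ↔ f α = 0 := by
  have hn := nilradicalSubmodule_eq_gradedPartGE hf hHq hq
  have hsup := hm.sup_eq
  have hdisj := hm.disjoint
  rw [hn] at hsup hdisj
  obtain ⟨e, he, he0⟩ := α.1.exists_ne_zero
  constructor
  · intro h
    have h1 := (hq α).mp (h.trans (le_sup_left.trans_eq hsup))
    by_contra h2
    exact he0 (Submodule.disjoint_def.mp hdisj e (h he)
      (rootSpace_le_gradedPartGE hf (by lia) he))
  · intro h
    by_contra hle
    have hα0 := H.isNonZero_coe_root α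
    -- If `m` misses the root `α` of degree zero, then `m` and the nilradical both lie in the sum of
    -- the other weight spaces, and so does `q`.
    have hmle : m.toSubmodule ≤
        ⨆ χ ∈ {χ | χ ≠ α.1}, (rootSpace H (χ : H → ℂ)).toSubmodule := by
      refine le_of_forall_mem_genWeightSpace (H := H) (fun h x hx ↦ m.lie_mem (hHm h.2) hx)
        fun χ z hz hzχ ↦ ?_
      by_cases hz0 : z = 0
      · simp [hz0]
      refine Submodule.mem_iSup_of_mem χ (Submodule.mem_iSup_of_mem ?_ hzχ)
      rintro rfl
      exact hle (rootSpace_le_of_mem hα0 hzχ hz0 hz)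
    have hnle : gradedPartGE (h₀ : 𝔤) 1 ≤
        ⨆ χ ∈ {χ | χ ≠ α.1}, (rootSpace H (χ : H → ℂ)).toSubmodule := by
      refine (gradedPartGE_le_iSup_rootSpace hf one_pos).trans (biSup_mono ?_)
      rintro _ ⟨β, rfl, hβ⟩ h'
      obtain rfl := Subtype.ext h'
      lia
    have heq : e ∈ q.toSubmodule := (hq α).mpr h.ge he
    rw [← hsup] at heq
    exact he0 (eq_zero_of_mem_rootSpace_of_mem_iSup he (by simp) (sup_le hmle hnle heq))

end Nilradical

/-! ### The center of the Levi factor and its weight spaces -/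

section TRootSpaces

open LieAlgebra LieAlgebra.IsKilling LieModule Module

variable {𝔤 : Type*} [LieRing 𝔤] [LieAlgebra ℂ 𝔤]

lemma lie_eq_zero_of_mem_center {m : LieSubalgebra ℂ 𝔤} (x : center ℂ m) {y : 𝔤} (hy : y ∈ m) :
    ⁅((x : m) : 𝔤), y⁆ = 0 := by
  have h : ⁅(⟨y, hy⟩ : m), (x : m)⁆ = 0 :=
    (LieModule.mem_maxTrivSubmodule (R := ℂ) (L := m) (M := m) (x : m)).mp x.2 ⟨y, hy⟩
  rw [← lie_skew, neg_eq_zero]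
  exact congrArg Subtype.val h

lemma lie_mem_tRootSpace {m : LieSubalgebra ℂ 𝔤} {ν μ : Dual ℂ (center ℂ m)} {y z : 𝔤}
    (hy : y ∈ tRootSpace m ν) (hz : z ∈ tRootSpace m μ) : ⁅y, z⁆ ∈ tRootSpace m (ν + μ) := by
  intro x
  rw [leibniz_lie, hy x, hz x, smul_lie, lie_smul, ← add_smul, LinearMap.add_apply]

lemma le_tRootSpace_zero (m : LieSubalgebra ℂ 𝔤) :
    m.toSubmodule ≤ (tRootSpace m 0).toSubmodule := fun y hy x ↦ by
  rw [lie_eq_zero_of_mem_center x hy, LinearMap.zero_apply, zero_smul]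

lemma iSupIndep_tRootSpace (m : LieSubalgebra ℂ 𝔤) [FiniteDimensional ℂ 𝔤] :
    iSupIndep (fun ν : Dual ℂ (center ℂ m) ↦ tRootSpace m ν) := by
  have h := LieSubmodule.iSupIndep_toSubmodule.mpr (iSupIndep_genWeightSpace ℂ (center ℂ m) 𝔤)
  rw [← LieSubmodule.iSupIndep_toSubmodule]
  have h' := h.comp (f := fun ν : Dual ℂ (center ℂ m) ↦ (ν : center ℂ m → ℂ))
    DFunLike.coe_injective
  refine h'.mono fun ν z hz ↦ ?_
  exact weightSpace_le_genWeightSpace 𝔤 (ν : center ℂ m → ℂ)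
    ((mem_weightSpace _ _).mpr fun x ↦ hz x)

variable [FiniteDimensional ℂ 𝔤]
  [LieAlgebra.IsSemisimple ℂ 𝔤] {H : LieSubalgebra ℂ 𝔤} [H.IsCartanSubalgebra]
  {m : LieSubalgebra ℂ 𝔤} {h₀ : H} {f : H.root → ℤ}

omit [FiniteDimensional ℂ 𝔤] [IsSemisimple ℂ 𝔤] in
lemma center_mem_cartan (hHm : H ≤ m) (x : center ℂ m) : ((x : m) : 𝔤) ∈ H := by
  rw [← LieSubalgebra.IsCartanSubalgebra.self_normalizing (H := H),
    LieSubalgebra.mem_normalizer_iff]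
  intro y hy
  rw [lie_eq_zero_of_mem_center x (hHm hy)]
  exact H.zero_mem

/-- The center of a subalgebra containing a Cartan subalgebra lies in the Cartan subalgebra. -/
def centerToCartan (hHm : H ≤ m) : center ℂ m →ₗ[ℂ] H where
  toFun x := ⟨(x : m), center_mem_cartan hHm x⟩
  map_add' _ _ := rfl
  map_smul' _ _ := rfl

/-- The restriction of a weight of the Cartan subalgebra to the center of `m`. -/
noncomputable def weightRestrict (hHm : H ≤ m) (χ : Weight ℂ H 𝔤) : Dual ℂ (center ℂ m) :=
  χ.toLinear ∘ₗ centerToCartan hHm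

omit [IsSemisimple ℂ 𝔤] in
lemma weightRestrict_apply (hHm : H ≤ m) (χ : Weight ℂ H 𝔤) (x : center ℂ m) :
    weightRestrict hHm χ x = χ (centerToCartan hHm x) := rfl

omit [IsSemisimple ℂ 𝔤] in
lemma weightRestrict_of_isZero (hHm : H ≤ m) {χ : Weight ℂ H 𝔤} (hχ : χ.IsZero) :
    weightRestrict hHm χ = 0 := by
  ext x
  simp [weightRestrict_apply, hχ.eq]

lemma mem_tRootSpace_of_mem_rootSpace (hHm : H ≤ m) {χ : Weight ℂ H 𝔤} {z : 𝔤}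
    (hz : z ∈ rootSpace H χ) : z ∈ tRootSpace m (weightRestrict hHm χ) :=
  fun x ↦ lie_eq_smul_of_mem_rootSpace hz (centerToCartan hHm x)

lemma eq_weightRestrict (hHm : H ≤ m) {χ : Weight ℂ H 𝔤} {z : 𝔤} (hz : z ∈ rootSpace H χ)
    (hz0 : z ≠ 0) {ν : Dual ℂ (center ℂ m)} (hν : z ∈ tRootSpace m ν) :
    ν = weightRestrict hHm χ := by
  ext x
  exact smul_left_injective ℂ hz0
    ((hν x).symm.trans (mem_tRootSpace_of_mem_rootSpace hHm hz x))

omit [IsSemisimple ℂ 𝔤] in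
lemma LieSubmodule.le_of_forall_mem_rootSpace (hHm : H ≤ m) {N : LieSubmodule ℂ m 𝔤}
    {W : Submodule ℂ 𝔤} (hW : ∀ χ : Weight ℂ H 𝔤, ∀ z ∈ N, z ∈ rootSpace H χ → z ∈ W) :
    N.toSubmodule ≤ W :=
  le_of_forall_mem_genWeightSpace (H := H) (fun h _ hx ↦ N.lie_mem (x := ⟨h, hHm h.2⟩) hx) hW

omit [IsSemisimple ℂ 𝔤] in
lemma exists_mem_rootSpace_of_ne_bot (hHm : H ≤ m) {N : LieSubmodule ℂ m 𝔤} (hN : N ≠ ⊥) :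
    ∃ (χ : Weight ℂ H 𝔤) (z : 𝔤), z ∈ N ∧ z ∈ rootSpace H χ ∧ z ≠ 0 := by
  by_contra! h
  refine hN ((LieSubmodule.eq_bot_iff _).mpr fun z hz ↦ ?_)
  have := LieSubmodule.le_of_forall_mem_rootSpace (W := ⊥) hHm (N := N)
    (fun χ z hz hzχ ↦ by simpa using h χ z hz hzχ) hz
  simpa using this

/-- `m` is the centralizer of `h₀`. -/
structure IsZeroPart (m : LieSubalgebra ℂ 𝔤) (h₀ : H) (f : H.root → ℤ) : Prop where
  cartan_le : H ≤ m
  apply_eq : ∀ α : H.root, α.1 h₀ = f α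
  rootSpace_le_iff : ∀ α : H.root, (rootSpace H α.1).toSubmodule ≤ m.toSubmodule ↔ f α = 0

namespace IsZeroPart

variable (hm : IsZeroPart m h₀ f)
include hm

lemma mem_center {h : H} (hh : ∀ α : H.root, f α = 0 → α.1 h = 0) :
    (⟨h, hm.cartan_le h.2⟩ : m) ∈ center ℂ m := by
  rw [LieModule.mem_maxTrivSubmodule]
  have hle : m.toSubmodule ≤ LinearMap.ker (ad ℂ 𝔤 (h : 𝔤)) := by
    refine le_of_forall_mem_genWeightSpace (H := H)
      (fun h x hx ↦ m.lie_mem (hm.cartan_le h.2) hx) fun χ z hz hzχ ↦ ?_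
    have h1 : ⁅(h : 𝔤), z⁆ = χ h • z := lie_eq_smul_of_mem_rootSpace hzχ h
    rw [LinearMap.mem_ker, ad_apply, h1]
    by_cases hχ : χ.IsZero
    · rw [hχ.eq, Pi.zero_apply, zero_smul]
    · by_cases hz0 : z = 0
      · rw [hz0, smul_zero]
      rw [hh ⟨χ, by simpa using hχ⟩ ((hm.rootSpace_le_iff _).mp
        (rootSpace_le_of_mem hχ hzχ hz0 hz)), zero_smul]
  intro y
  have h1 : ⁅(h : 𝔤), (y : 𝔤)⁆ = 0 := hle y.2
  refine Subtype.ext ?_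
  change ⁅(y : 𝔤), (h : 𝔤)⁆ = 0
  rw [← lie_skew, h1, neg_zero]

/-- The element `h₀` is itself central in `m`, so the restriction to the center still sees the
degree. -/
lemma weightRestrict_eq_zero_iff (α : H.root) :
    weightRestrict hm.cartan_le α.1 = 0 ↔ f α = 0 := by
  constructor
  · intro h
    have hc := hm.mem_center (h := h₀) fun α hα ↦ by rw [hm.apply_eq, hα, Int.cast_zero]
    have h1 := LinearMap.congr_fun h ⟨_, hc⟩
    have h2 : α.1 h₀ = 0 := h1
    rw [hm.apply_eq] at h2
    exact_mod_cast h2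
  · intro h
    obtain ⟨e, he, he0⟩ := α.1.exists_ne_zero
    exact (eq_weightRestrict hm.cartan_le he he0
      (le_tRootSpace_zero m ((hm.rootSpace_le_iff α).mpr h he))).symm

lemma tRootSpace_zero : (tRootSpace m 0).toSubmodule = m.toSubmodule := by
  refine le_antisymm (LieSubmodule.le_of_forall_mem_rootSpace hm.cartan_le fun χ z hz hzχ ↦ ?_)
    (le_tRootSpace_zero m)
  by_cases hχ : χ.IsZero
  · exact hm.cartan_le (mem_cartan_of_mem_rootSpace_zero hχ hzχ)
  · by_cases hz0 : z = 0
    · simp [hz0]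
    have h1 := (eq_weightRestrict hm.cartan_le hzχ hz0 hz).symm
    let α : H.root := ⟨χ, by simpa using hχ⟩
    exact (hm.rootSpace_le_iff α).mpr ((hm.weightRestrict_eq_zero_iff α).mp h1) hzχ

lemma lie_mem_of_mem_tRootSpace {ν : Dual ℂ (center ℂ m)} {y z : 𝔤} (hy : y ∈ tRootSpace m ν)
    (hz : z ∈ tRootSpace m (-ν)) : ⁅y, z⁆ ∈ m := by
  have h := lie_mem_tRootSpace hy hz
  rw [add_neg_cancel] at h
  exact hm.tRootSpace_zero.le h

/-- The Killing form pairs the spaces `𝔤_ν` and `𝔤_{-ν}` non-degenerately. -/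
lemma eq_zero_of_forall_killingForm_eq_zero {ν : Dual ℂ (center ℂ m)} {y : 𝔤}
    (hy : y ∈ tRootSpace m ν) (h : ∀ z ∈ tRootSpace m (-ν), killingForm ℂ 𝔤 y z = 0) : y = 0 := by
  have hle : (⊤ : Submodule ℂ 𝔤) ≤ LinearMap.ker (killingForm ℂ 𝔤 y) := by
    refine le_of_forall_mem_genWeightSpace (H := H) (fun _ _ _ ↦ trivial) fun χ z _ hzχ ↦ ?_
    have hz := mem_tRootSpace_of_mem_rootSpace hm.cartan_le hzχ
    rw [LinearMap.mem_ker]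
    by_cases hχ : weightRestrict hm.cartan_le χ = -ν
    · exact h z (hχ ▸ hz)
    -- If the weights do not cancel, some `x` in `𝔱` detects it, and invariance of the form makes
    -- the two spaces orthogonal.
    · obtain ⟨x, hx⟩ : ∃ x, (ν + weightRestrict hm.cartan_le χ) x ≠ 0 := by
        by_contra! h0
        exact hχ (eq_neg_of_add_eq_zero_right (LinearMap.ext h0))
      have h1 := LieModule.traceForm_apply_lie_apply ℂ 𝔤 𝔤 y ((x : m) : 𝔤) z
      rw [← lie_skew, hy x, hz x] at h1
      simp only [map_neg, map_smul, LinearMap.neg_apply, LinearMap.smul_apply, smul_eq_mul] at h1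
      rw [LinearMap.add_apply] at hx
      have h2 : (ν x + weightRestrict hm.cartan_le χ x) * killingForm ℂ 𝔤 y z = 0 := by
        change (ν x + weightRestrict hm.cartan_le χ x) * traceForm ℂ 𝔤 𝔤 y z = 0
        linear_combination -h1
      exact (mul_eq_zero.mp h2).resolve_left hx
  have hker : y ∈ LinearMap.ker (killingForm ℂ 𝔤) :=
    LinearMap.ext fun z ↦ LinearMap.mem_ker.mp (hle (Submodule.mem_top (x := z)))
  rwa [IsKilling.ker_killingForm_eq_bot, Submodule.mem_bot] at hker

end IsZeroPart

end TRootSpaces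

/-! ### Irreducibility of the `𝔱`-root spaces over `m` -/

section Irreducible

open LieAlgebra LieAlgebra.IsKilling LieModule Module

variable {𝔤 : Type*} [LieRing 𝔤] [LieAlgebra ℂ 𝔤] [FiniteDimensional ℂ 𝔤]
  [LieAlgebra.IsSemisimple ℂ 𝔤] {H : LieSubalgebra ℂ 𝔤} [H.IsCartanSubalgebra]
  {m : LieSubalgebra ℂ 𝔤} {h₀ : H} {f : H.root → ℤ}

namespace IsZeroPart

lemma weightRestrict_eq_add {hHm : H ≤ m} {a b c : H.root}
    (h : (rootSystem H).root c = (rootSystem H).root a + (rootSystem H).root b) :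
    weightRestrict hHm c.1 = weightRestrict hHm a.1 + weightRestrict hHm b.1 := by
  ext x
  exact congrFun (coe_eq_add_of_root_eq_add h) (centerToCartan hHm x)

variable (hm : IsZeroPart m h₀ f)
include hm

/-- The set of roots whose root spaces lie in an `m`-submodule is closed under adding roots of
`m`. -/
lemma rootSpace_le_of_root_eq_add {N : LieSubmodule ℂ m 𝔤} {i a c : H.root} (hi : f i = 0)
    (ha : (rootSpace H a.1).toSubmodule ≤ N.toSubmodule)
    (hc : (rootSystem H).root c = (rootSystem H).root a + (rootSystem H).root i) :
    (rootSpace H c.1).toSubmodule ≤ N.toSubmodule := by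
  rw [add_comm] at hc
  exact rootSpace_le_of_lie_mem (H.isNonZero_coe_root i) (H.isNonZero_coe_root a)
    (H.isNonZero_coe_root c) (coe_eq_add_of_root_eq_add hc)
    fun x hx y hy ↦ N.lie_mem (x := ⟨x, (hm.rootSpace_le_iff i).mpr hi hx⟩) (ha hy)

/-- A `𝔱`-root space has no proper non-zero `m`-submodules. -/
theorem eq_tRootSpace_of_le {ν : Dual ℂ (center ℂ m)} (hν : ν ≠ 0) {N : LieSubmodule ℂ m 𝔤}
    (hN : N ≤ tRootSpace m ν) (hN0 : N ≠ ⊥) : N = tRootSpace m ν := by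
  classical
  let P := rootSystem H
  have hroot {χ : Weight ℂ H 𝔤} {z : 𝔤} (hz : z ∈ rootSpace H χ) (hz0 : z ≠ 0)
      (hzν : z ∈ tRootSpace m ν) : χ.IsNonZero := fun hχ ↦
    hν ((eq_weightRestrict hm.cartan_le hz hz0 hzν).trans
      (weightRestrict_of_isZero hm.cartan_le hχ))
  let X : Finset H.root := {α | (rootSpace H α.1).toSubmodule ≤ N.toSubmodule}
  have hX {α} : α ∈ X ↔ (rootSpace H α.1).toSubmodule ≤ N.toSubmodule := by simp [X]
  have hXν {α} (hα : α ∈ X) : weightRestrict hm.cartan_le α.1 = ν := by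
    obtain ⟨e, he, he0⟩ := α.1.exists_ne_zero
    exact (eq_weightRestrict hm.cartan_le he he0 (hN (hX.mp hα he))).symm
  have hXne : X.Nonempty := by
    obtain ⟨χ, z, hzN, hzχ, hz0⟩ := exists_mem_rootSpace_of_ne_bot hm.cartan_le hN0
    have hχ := hroot hzχ hz0 (hN hzN)
    exact ⟨⟨χ, by simpa using hχ⟩, hX.mpr (rootSpace_le_of_mem hχ hzχ hz0 hzN)⟩
  refine le_antisymm hN (LieSubmodule.le_of_forall_mem_rootSpace hm.cartan_le fun χ z hz hzχ ↦ ?_)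
  by_cases hz0 : z = 0
  · simp [hz0]
  let y : H.root := ⟨χ, by simpa using hroot hzχ hz0 hz⟩
  have hyν : weightRestrict hm.cartan_le y.1 = ν :=
    (eq_weightRestrict hm.cartan_le hzχ hz0 hz).symm
  suffices hy : y ∈ X from hX.mp hy hzχ
  by_contra hyX
  obtain ⟨v, g, hvg, hg0, hgle, hgsum⟩ := RootPairing.exists_coweight_of_finset (P := P) X
  have hvf (i : H.root) : i.1 v = g i := hvg i
  have hadd {i} (hi : f i = 0) : ∀ a ∈ X, ∀ c, P.root c = P.root a + P.root i → c ∈ X :=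
    fun a ha c hc ↦ hX.mpr (hm.rootSpace_le_of_root_eq_add hi (hX.mp ha) hc)
  have hnegroot (i) : P.root (negRoot i) = -P.root i := rfl
  have hfneg {i} (hi : f i = 0) : f (negRoot i) = 0 := by
    rw [apply_negRoot hm.apply_eq, hi, neg_zero]
  have hne {i} (hi : f i = 0) : ∀ a ∈ X, P.root a ≠ P.root i := by
    rintro a ha h
    obtain rfl := P.root.injective h
    exact hν ((hXν ha).symm.trans ((hm.weightRestrict_eq_zero_iff a).mpr hi))
  -- `v` is dual to the sum of `X`. No root of `m` or its negative lies in `X`, since `ν ≠ 0`, so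
  -- the reflection argument applies.
  have hvc := hm.mem_center (h := v) fun i hi ↦ by
    rw [hvf, hg0, Int.cast_zero]
    refine RootPairing.sum_pairingIn_left_eq_zero (hadd hi) (fun a ha c hc ↦ ?_) ?_ (hne hi)
    · exact hadd (hfneg hi) a ha c (by rw [hc, hnegroot, sub_eq_add_neg])
    · exact fun a ha ↦ hnegroot i ▸ hne (hfneg hi) a ha
  have hgν {i} (hi : weightRestrict hm.cartan_le i.1 = ν) : (g i : ℂ) = ν ⟨_, hvc⟩ := by
    rw [← hi, ← hvf]
    rfl
  -- An acute angle between `y` and some `a` in `X` would make `y - a` a root of `m`, putting `y` in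
  -- `X`.
  have hgy : g y ≤ 0 := by
    refine hgle y fun a ha ↦ ?_
    by_contra! hpos
    obtain ⟨i, hi⟩ := P.root_sub_root_mem_of_pairingIn_pos hpos (fun h ↦ hyX (h ▸ ha))
    have hsum : P.root y = P.root a + P.root i := by rw [hi]; abel
    have h1 := weightRestrict_eq_add (hHm := hm.cartan_le) hsum
    rw [hyν, hXν ha, left_eq_add] at h1
    exact hyX (hadd ((hm.weightRestrict_eq_zero_iff i).mp h1) a ha y hsum)
  have hg (a) (ha : a ∈ X) : g a = g y := by
    exact_mod_cast (hgν (hXν ha)).trans (hgν hyν).symm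
  have hpair := hgsum (Finset.sum_nonpos fun a ha ↦ (hg a ha).trans_le hgy)
  have hzero : ∑ a ∈ X, P.root a = 0 := by
    refine LinearMap.ext_on (RootPairing.IsRootSystem.span_coroot_eq_top (P := P)) ?_
    rintro _ ⟨i, rfl⟩
    have h1 : (∑ a ∈ X, P.root a) (P.coroot i) = ((∑ a ∈ X, P.pairingIn ℤ a i : ℤ) : ℂ) := by
      rw [LinearMap.sum_apply, Int.cast_sum]
      refine Finset.sum_congr rfl fun a _ ↦ ?_
      have := P.algebraMap_pairingIn ℤ a i
      rw [eq_intCast] at this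
      rw [this]
      rfl
    rw [h1, hpair, Int.cast_zero, LinearMap.zero_apply]
  -- On the center every root of `X` restricts to `ν`, so the vanishing sum reads `|X| ν = 0`.
  refine hν (LinearMap.ext fun x ↦ ?_)
  have h1 := LinearMap.congr_fun hzero (centerToCartan hm.cartan_le x)
  rw [LinearMap.sum_apply, Finset.sum_congr rfl (g := fun _ ↦ ν x)
    (fun a ha ↦ show P.root a (centerToCartan hm.cartan_le x) = ν x from
      LinearMap.congr_fun (hXν ha) x), Finset.sum_const, LinearMap.zero_apply,
    smul_eq_zero] at h1
  exact h1.resolve_left (Finset.card_ne_zero.mpr hXne)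

end IsZeroPart

end Irreducible

/-! ### Splitting `m` by means of the Killing form -/

section Orthogonality

open LieAlgebra LieAlgebra.IsKilling LieModule Module

/-- An element of the span of the brackets of endomorphisms preserving a finite-dimensional non-zero
subspace has trace zero there, hence cannot act on it by a non-zero scalar. -/
lemma eq_zero_of_mem_span_lie_of_lie_eq_smul {K L : Type*} [Field K] [CharZero K] [LieRing L]
    [LieAlgebra K L] [FiniteDimensional K L] {V : Submodule K L} (hV : V ≠ ⊥) {S : Set L}
    (hS : ∀ s ∈ S, ∃ y z : L, (∀ v ∈ V, ⁅y, v⁆ ∈ V) ∧ (∀ v ∈ V, ⁅z, v⁆ ∈ V) ∧ ⁅y, z⁆ = s)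
    {x : L} (hx : x ∈ Submodule.span K S) {c : K} (hc : ∀ v ∈ V, ⁅x, v⁆ = c • v) : c = 0 := by
  -- Compressing by a projection onto `V` makes the action linear on all of `L`; it is the true
  -- action for elements preserving `V`.
  obtain ⟨p, hp⟩ := V.subtype.exists_leftInverse_of_injective V.ker_subtype
  have hp (v : L) (hv : v ∈ V) : (p v : L) = v :=
    congrArg Subtype.val (LinearMap.congr_fun hp ⟨v, hv⟩)
  let F : L →ₗ[K] End K V :=
    { toFun := fun x ↦ p ∘ₗ ad K L x ∘ₗ V.subtype
      map_add' := fun x y ↦ by ext v; simp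
      map_smul' := fun c x ↦ by ext v; simp }
  have hF (x : L) (v : V) (h : ⁅x, (v : L)⁆ ∈ V) : (F x v : L) = ⁅x, (v : L)⁆ := hp _ h
  have hle : Submodule.span K S ≤ LinearMap.ker (LinearMap.trace K V ∘ₗ F) := by
    refine Submodule.span_le.mpr fun s hs ↦ ?_
    obtain ⟨y, z, hy, hz, rfl⟩ := hS s hs
    have h1 : F ⁅y, z⁆ = F y * F z - F z * F y := by
      ext v
      have hyv := hy v v.2
      have hzv := hz v v.2
      have h2 : ⁅⁅y, z⁆, (v : L)⁆ = ⁅y, ⁅z, (v : L)⁆⁆ - ⁅z, ⁅y, (v : L)⁆⁆ := lie_lie y z (v : L)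
      rw [hF _ v (h2 ▸ sub_mem (hy _ hzv) (hz _ hyv)), h2, LinearMap.sub_apply,
        Module.End.mul_apply, Module.End.mul_apply, Submodule.coe_sub,
        hF y _ (hy _ (Subtype.prop _)), hF z v hzv, hF z _ (hz _ (Subtype.prop _)), hF y v hyv]
    rw [SetLike.mem_coe, LinearMap.mem_ker, LinearMap.comp_apply, h1, map_sub,
      LinearMap.trace_mul_comm, sub_self]
  have h0 : LinearMap.trace K V (F x) = 0 := hle hx
  have h1 : F x = c • LinearMap.id := by
    ext v
    rw [hF x v (hc v v.2 ▸ V.smul_mem c v.2), hc v v.2]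
    rfl
  rw [h1, map_smul, LinearMap.trace_id, smul_eq_mul, mul_eq_zero, Nat.cast_eq_zero,
    Submodule.finrank_eq_zero] at h0
  exact h0.resolve_right hV

/-- A subspace on which a reflexive bilinear form is non-degenerate splits off orthogonally. -/
lemma LinearMap.BilinForm.exists_mem_forall_apply_sub_eq_zero {K V : Type*} [Field K]
    [AddCommGroup V] [Module K V] [FiniteDimensional K V] {B : LinearMap.BilinForm K V}
    (hB : LinearMap.IsSymm B) {W : Submodule K V} (hW : ∀ x ∈ W, (∀ y ∈ W, B x y = 0) → x = 0) (x : V) :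
    ∃ a ∈ W, ∀ y ∈ W, B (x - a) y = 0 := by
  have hsymm (x y) : B x y = B y x := by simpa using hB.eq x y
  have hnd : (B.restrict W).Nondegenerate :=
    ⟨fun x hx ↦ Subtype.ext (hW x x.2 fun y hy ↦ hx ⟨y, hy⟩),
      fun x hx ↦ Subtype.ext (hW x x.2 fun y hy ↦ by rw [hsymm]; exact hx ⟨y, hy⟩)⟩
  have hcompl := LinearMap.BilinForm.isCompl_orthogonal_of_restrict_nondegenerate hB.isRefl hnd
  obtain ⟨a, ha, c, hc, rfl⟩ := Submodule.mem_sup.mp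
    (hcompl.sup_eq_top.ge (Submodule.mem_top (x := x)))
  refine ⟨a, ha, fun y hy ↦ ?_⟩
  rw [add_sub_cancel_left, hsymm]
  exact hc y hy

variable {𝔤 : Type*} [LieRing 𝔤] [LieAlgebra ℂ 𝔤] [FiniteDimensional ℂ 𝔤]
  [LieAlgebra.IsSemisimple ℂ 𝔤] {H : LieSubalgebra ℂ 𝔤} [H.IsCartanSubalgebra]
  {m : LieSubalgebra ℂ 𝔤} {h₀ : H} {f : H.root → ℤ}

omit [FiniteDimensional ℂ 𝔤] [IsSemisimple ℂ 𝔤] in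
lemma killingForm_lie_apply (x y z : 𝔤) :
    killingForm ℂ 𝔤 ⁅x, y⁆ z = killingForm ℂ 𝔤 x ⁅y, z⁆ :=
  LieModule.traceForm_apply_lie_apply ℂ 𝔤 𝔤 x y z

/-- The span of the brackets of elements of `m`. -/
def derivedSpan (m : LieSubalgebra ℂ 𝔤) : Submodule ℂ 𝔤 :=
  Submodule.span ℂ {x | ∃ y ∈ m, ∃ z ∈ m, ⁅y, z⁆ = x}

/-- The span of the brackets of elements of `𝔤_ν` and `𝔤_{-ν}`. -/
def bracketSpan (m : LieSubalgebra ℂ 𝔤) (ν : Dual ℂ (center ℂ m)) : Submodule ℂ 𝔤 :=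
  Submodule.span ℂ {x | ∃ y ∈ tRootSpace m ν, ∃ z ∈ tRootSpace m (-ν), ⁅y, z⁆ = x}

omit [FiniteDimensional ℂ 𝔤] [IsSemisimple ℂ 𝔤] in
lemma derivedSpan_le : derivedSpan m ≤ m.toSubmodule := by
  refine Submodule.span_le.mpr ?_
  rintro _ ⟨y, hy, z, hz, rfl⟩
  exact m.lie_mem hy hz

omit [FiniteDimensional ℂ 𝔤] [IsSemisimple ℂ 𝔤] in
lemma exists_mem_derivedIdeal {x : 𝔤} (hx : x ∈ derivedSpan m) :
    ∃ y ∈ derivedIdeal m, (y : 𝔤) = x := by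
  have hle : derivedSpan m ≤ (derivedIdeal m).toSubmodule.map m.toSubmodule.subtype := by
    refine Submodule.span_le.mpr ?_
    rintro _ ⟨y, hy, z, hz, rfl⟩
    exact ⟨⁅(⟨y, hy⟩ : m), (⟨z, hz⟩ : m)⁆,
      LieSubmodule.lie_mem_lie (LieSubmodule.mem_top _) (LieSubmodule.mem_top _), rfl⟩
  exact hle hx

namespace IsZeroPart

variable (hm : IsZeroPart m h₀ f)
include hm

lemma bracketSpan_le (ν : Dual ℂ (center ℂ m)) : bracketSpan m ν ≤ m.toSubmodule := by
  refine Submodule.span_le.mpr ?_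
  rintro _ ⟨y, hy, z, hz, rfl⟩
  exact hm.lie_mem_of_mem_tRootSpace hy hz

/-- By invariance `⁅x, m⁆` is orthogonal to `m = 𝔤_0`, where the form is non-degenerate. -/
lemma mem_center_of_forall_killingForm_eq_zero {x : 𝔤} (hx : x ∈ m)
    (h : ∀ y ∈ derivedSpan m, killingForm ℂ 𝔤 x y = 0) : (⟨x, hx⟩ : m) ∈ center ℂ m := by
  rw [LieModule.mem_maxTrivSubmodule]
  intro y
  have h0 : ⁅x, (y : 𝔤)⁆ = 0 := by
    refine hm.eq_zero_of_forall_killingForm_eq_zero (ν := 0)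
      (le_tRootSpace_zero m (m.lie_mem hx y.2)) fun z hz ↦ ?_
    rw [neg_zero] at hz
    rw [killingForm_lie_apply]
    exact h _ (Submodule.subset_span ⟨y, y.2, z, hm.tRootSpace_zero.le hz, rfl⟩)
  refine Subtype.ext ?_
  change ⁅(y : 𝔤), x⁆ = 0
  rw [← lie_skew, h0, neg_zero]

lemma eq_zero_of_forall_weightRestrict_eq_zero {x : center ℂ m}
    (h : ∀ α : H.root, weightRestrict hm.cartan_le α.1 x = 0) : ((x : m) : 𝔤) = 0 :=
  congrArg Subtype.val (eq_zero_of_forall_root_apply_eq_zero (h := centerToCartan hm.cartan_le x) h)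

lemma tRootSpace_weightRestrict_ne_bot (χ : Weight ℂ H 𝔤) :
    (tRootSpace m (weightRestrict hm.cartan_le χ)).toSubmodule ≠ ⊥ := by
  obtain ⟨e, he, he0⟩ := χ.exists_ne_zero
  exact (Submodule.ne_bot_iff _).mpr ⟨e, mem_tRootSpace_of_mem_rootSpace hm.cartan_le he, he0⟩

/-- Such an `x` is central, hence a scalar on every `𝔱`-weight space. Being a sum of brackets in
`m`, it has trace zero there, so all roots vanish on it. -/
lemma eq_zero_of_mem_derivedSpan {x : 𝔤} (hx : x ∈ derivedSpan m)
    (h : ∀ y ∈ derivedSpan m, killingForm ℂ 𝔤 x y = 0) : x = 0 := by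
  have hc := hm.mem_center_of_forall_killingForm_eq_zero (derivedSpan_le hx) h
  refine hm.eq_zero_of_forall_weightRestrict_eq_zero (x := ⟨_, hc⟩) fun α ↦ ?_
  refine eq_zero_of_mem_span_lie_of_lie_eq_smul (hm.tRootSpace_weightRestrict_ne_bot α.1) ?_ hx
    fun v hv ↦ hv ⟨_, hc⟩
  rintro _ ⟨y, hy, z, hz, rfl⟩
  exact ⟨y, z, fun v hv ↦ LieSubmodule.lie_mem _ (x := (⟨y, hy⟩ : m)) hv,
    fun v hv ↦ LieSubmodule.lie_mem _ (x := (⟨z, hz⟩ : m)) hv, rfl⟩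

/-- `m` is the sum of its derived algebra and its center. -/
lemma exists_sub_mem_center (x : m) : ∃ a ∈ derivedIdeal m, x - a ∈ center ℂ m := by
  obtain ⟨a, ha, h⟩ := LinearMap.BilinForm.exists_mem_forall_apply_sub_eq_zero
    (LieModule.traceForm_isSymm ℂ 𝔤 𝔤) (fun _ ↦ hm.eq_zero_of_mem_derivedSpan) (x : 𝔤)
  obtain ⟨a, ha', rfl⟩ := exists_mem_derivedIdeal ha
  exact ⟨a, ha', hm.mem_center_of_forall_killingForm_eq_zero (x - a).2 h⟩

lemma lie_eq_zero_of_forall_killingForm_eq_zero {ν : Dual ℂ (center ℂ m)} {x : 𝔤} (hx : x ∈ m)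
    (h : ∀ y ∈ bracketSpan m ν, killingForm ℂ 𝔤 x y = 0) :
    ∀ y ∈ tRootSpace m ν, ⁅x, y⁆ = 0 := by
  intro y hy
  refine hm.eq_zero_of_forall_killingForm_eq_zero
    ((tRootSpace m ν).lie_mem (x := ⟨x, hx⟩) hy) fun z hz ↦ ?_
  rw [killingForm_lie_apply]
  exact h _ (Submodule.subset_span ⟨y, hy, z, hz, rfl⟩)

omit [FiniteDimensional ℂ 𝔤] [IsSemisimple ℂ 𝔤] [H.IsCartanSubalgebra] hm in
lemma killingForm_eq_zero_of_forall_lie_eq_zero {ν : Dual ℂ (center ℂ m)} {x y : 𝔤}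
    (hx : ∀ z ∈ tRootSpace m ν, ⁅x, z⁆ = 0) (hy : y ∈ bracketSpan m ν) :
    killingForm ℂ 𝔤 x y = 0 := by
  have hle : bracketSpan m ν ≤ LinearMap.ker (killingForm ℂ 𝔤 x) := by
    refine Submodule.span_le.mpr ?_
    rintro _ ⟨y, hy, z, -, rfl⟩
    rw [SetLike.mem_coe, LinearMap.mem_ker, ← killingForm_lie_apply, hx y hy, map_zero,
      LinearMap.zero_apply]
  exact hle hy

lemma eq_zero_of_mem_center_of_mem_bracketSpan {ν : Dual ℂ (center ℂ m)} {x : center ℂ m}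
    (hx : ((x : m) : 𝔤) ∈ bracketSpan m ν) (hν : ν x = 0) : ((x : m) : 𝔤) = 0 := by
  refine hm.eq_zero_of_forall_weightRestrict_eq_zero fun α ↦ ?_
  let μ := weightRestrict hm.cartan_le α.1
  -- The `ν`-string through `μ` is stable under `𝔤_ν` and `𝔤_{-ν}`. As `ν x = 0`, `x` acts on all of
  -- it by the scalar `μ x`, which the trace forces to vanish.
  let V : Submodule ℂ 𝔤 := ⨆ k : ℤ, (tRootSpace m (μ + k • ν)).toSubmodule
  have hV : V ≠ ⊥ := fun h ↦ hm.tRootSpace_weightRestrict_ne_bot α.1 (by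
    have := iSup_eq_bot.mp h 0
    rwa [zero_smul, add_zero] at this)
  have hstable {y : 𝔤} {j : ℤ} (hy : y ∈ tRootSpace m (j • ν)) : ∀ v ∈ V, ⁅y, v⁆ ∈ V := by
    intro v hv
    induction hv using Submodule.iSup_induction' with
    | zero => simp
    | add u v _ _ h1 h2 => rw [lie_add]; exact add_mem h1 h2
    | mem k u hu =>
      have h1 := lie_mem_tRootSpace hy hu
      rw [add_left_comm, ← add_smul] at h1
      exact Submodule.mem_iSup_of_mem (j + k) h1
  refine eq_zero_of_mem_span_lie_of_lie_eq_smul hV ?_ hx fun v hv ↦ ?_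
  · rintro _ ⟨y, hy, z, hz, rfl⟩
    exact ⟨y, z, hstable (j := 1) (by rwa [one_smul]), hstable (j := -1) (by rwa [neg_one_smul]),
      rfl⟩
  · have hle : V ≤ (ad ℂ 𝔤 ((x : m) : 𝔤)).eigenspace (μ x) := iSup_le fun k u hu ↦ by
      rw [Module.End.mem_eigenspace_iff, ad_apply, hu x]
      simp [hν]
    exact Module.End.mem_eigenspace_iff.mp (hle hv)

/-- `[𝔤_ν, 𝔤_{-ν}]` acts faithfully on `𝔤_ν`. -/
theorem eq_zero_of_mem_bracketSpan {ν : Dual ℂ (center ℂ m)} {x : 𝔤} (hx : x ∈ bracketSpan m ν)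
    (h : ∀ y ∈ tRootSpace m ν, ⁅x, y⁆ = 0) : x = 0 := by
  by_cases hbot : (tRootSpace m ν).toSubmodule = ⊥
  · have hb : bracketSpan m ν ≤ ⊥ := by
      refine Submodule.span_le.mpr ?_
      rintro _ ⟨y, hy, z, -, rfl⟩
      have : y = 0 := (Submodule.eq_bot_iff _).mp hbot y hy
      simp [this]
    simpa using hb hx
  -- The kernel of the action is an ideal of `m`, orthogonal to the whole bracket space. It is shown
  -- to have no non-zero weight vectors.
  let W : Submodule ℂ 𝔤 :=
    { carrier := {x | x ∈ bracketSpan m ν ∧ ∀ y ∈ tRootSpace m ν, ⁅x, y⁆ = 0}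
      add_mem' := fun {a b} ha hb ↦ ⟨add_mem ha.1 hb.1, fun y hy ↦ by
        rw [add_lie, ha.2 y hy, hb.2 y hy, add_zero]⟩
      zero_mem' := ⟨zero_mem _, fun y _ ↦ zero_lie y⟩
      smul_mem' := fun c a ha ↦ ⟨Submodule.smul_mem _ c ha.1, fun y hy ↦ by
        rw [smul_lie, ha.2 y hy, smul_zero]⟩ }
  have hideal {u : 𝔤} (hu : u ∈ m) {x : 𝔤} (hx : x ∈ W) : ⁅u, x⁆ ∈ W := by
    refine ⟨(tRootBracket m ν).lie_mem (x := ⟨u, hu⟩) (m := ⟨x, hm.bracketSpan_le ν hx.1⟩) hx.1,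
      fun y hy ↦ ?_⟩
    rw [lie_lie, hx.2 y hy, lie_zero,
      show ⁅x, ⁅u, y⁆⁆ = 0 from hx.2 _ ((tRootSpace m ν).lie_mem (x := ⟨u, hu⟩) hy),
      sub_zero]
  have hroot (α : H.root) {e : 𝔤} (he : e ∈ rootSpace H α.1) (heW : e ∈ W) : e = 0 := by
    by_contra he0
    have hle : (rootSpace H α.1).toSubmodule ≤ W :=
      rootSpace_le_of_mem (H.isNonZero_coe_root α) he he0 heW
    have hfα : f α = 0 := (hm.rootSpace_le_iff α).mp
      (hle.trans fun x hx ↦ hm.bracketSpan_le ν hx.1)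
    obtain ⟨h', e', g, ht, he', hg⟩ :=
      exists_isSl2Triple_of_weight_isNonZero (H.isNonZero_coe_root α)
    have hgm : g ∈ m := (hm.rootSpace_le_iff (negRoot α)).mpr
      (by rw [apply_negRoot hm.apply_eq, hfα, neg_zero]) hg
    have hh'W : h' ∈ W := by
      rw [← ht.lie_e_f, ← lie_skew]
      exact neg_mem (hideal hgm (hle he'))
    have hgW : g ∈ W := by
      have h1 := hideal hgm hh'W
      rw [← lie_skew, ht.lie_lie_smul_f ℂ, neg_neg] at h1
      simpa using W.smul_mem (2⁻¹ : ℂ) h1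
    -- Opposite root vectors in `W` would be orthogonal, whereas their bracket is a multiple of
    -- their Killing product and equals `h' ≠ 0`.
    have h2 := lie_eq_killingForm_smul_of_mem_rootSpace_of_mem_rootSpace_neg he' hg
    rw [killingForm_eq_zero_of_forall_lie_eq_zero (hle he').2 hgW.1, zero_smul, ht.lie_e_f] at h2
    exact ht.h_ne_zero h2
  have hW : W ≤ ⊥ := by
    refine le_of_forall_mem_genWeightSpace (H := H)
      (fun h x hx ↦ hideal (hm.cartan_le h.2) hx) fun χ z hz hzχ ↦ ?_
    rw [Submodule.mem_bot]
    by_cases hχ : χ.IsZero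
    · have hzH := mem_cartan_of_mem_rootSpace_zero hχ hzχ
      -- For a root `α` of `m`, `⁅z, e⁆` lies in `W`, which has no root vectors. So `α` vanishes at
      -- `z`, and `z` is central.
      have hc := hm.mem_center (h := ⟨z, hzH⟩) fun α hα ↦ by
        obtain ⟨e, he, he0⟩ := α.1.exists_ne_zero
        by_contra hne
        have h1 : ⁅z, e⁆ = α.1 ⟨z, hzH⟩ • e := lie_eq_smul_of_mem_rootSpace he ⟨z, hzH⟩
        have h2 : α.1 ⟨z, hzH⟩ • e ∈ W := by
          rw [← h1, ← lie_skew]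
          exact neg_mem (hideal ((hm.rootSpace_le_iff α).mpr hα he) hz)
        exact (smul_ne_zero hne he0) (hroot α (Submodule.smul_mem _ _ he) h2)
      obtain ⟨y, hy, hy0⟩ := (Submodule.ne_bot_iff _).mp hbot
      refine hm.eq_zero_of_mem_center_of_mem_bracketSpan (x := ⟨_, hc⟩) hz.1 ?_
      have h3 := hy ⟨_, hc⟩
      rw [show ⁅z, y⁆ = 0 from hz.2 y hy, eq_comm, smul_eq_zero] at h3
      exact h3.resolve_right hy0
    · exact hroot ⟨χ, by simpa using hχ⟩ hzχ hz
  simpa using hW (show x ∈ W from ⟨hx, h⟩)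

/-- `m` is the sum of `[𝔤_ν, 𝔤_{-ν}]` and the annihilator of `𝔤_ν`. -/
lemma exists_sub_lie_eq_zero (ν : Dual ℂ (center ℂ m)) (x : m) :
    ∃ a ∈ tRootBracket m ν, ∀ y ∈ tRootSpace m ν, ⁅((x - a : m) : 𝔤), y⁆ = 0 := by
  obtain ⟨a, ha, h⟩ := LinearMap.BilinForm.exists_mem_forall_apply_sub_eq_zero
    (LieModule.traceForm_isSymm ℂ 𝔤 𝔤) (W := bracketSpan m ν)
    (fun y hy h ↦ hm.eq_zero_of_mem_bracketSpan hy
      (hm.lie_eq_zero_of_forall_killingForm_eq_zero (hm.bracketSpan_le ν hy) h)) (x : 𝔤)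
  exact ⟨⟨a, hm.bracketSpan_le ν ha⟩, ha, hm.lie_eq_zero_of_forall_killingForm_eq_zero
    (x - ⟨a, hm.bracketSpan_le ν ha⟩).2 h⟩

end IsZeroPart

end Orthogonality

/-! ### Irreducible submodules as atoms, and restriction to ideals -/

section Submodules

open LieModule

variable {R L M : Type*} [CommRing R] [LieRing L] [LieAlgebra R L] [AddCommGroup M] [Module R M]
  [LieRingModule L M] [LieModule R L M]

/-- The submodules of a Lie submodule `N` are the submodules contained in `N`. -/
def LieSubmodule.orderIsoIic (N : LieSubmodule R L M) : LieSubmodule R L N ≃o Set.Iic N where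
  toFun K := ⟨K.map N.incl, by
    rintro _ ⟨x, -, rfl⟩
    exact x.2⟩
  invFun K := K.1.comap N.incl
  left_inv K := by
    ext x
    simp
  right_inv K := by
    refine Subtype.ext ?_
    ext x
    simpa using fun hx ↦ K.2 hx
  map_rel_iff' {K K'} := by
    refine ⟨fun h x hx ↦ ?_, fun h ↦ LieSubmodule.map_mono h⟩
    obtain ⟨y, hy, hyx⟩ := h ⟨x, hx, rfl⟩
    rwa [← Subtype.ext hyx]

omit [LieAlgebra R L] [LieModule R L M] in
lemma LieSubmodule.isIrreducible_iff_isAtom (N : LieSubmodule R L M) :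
    IsIrreducible R L N ↔ IsAtom N := by
  rw [← Set.isSimpleOrder_Iic_iff_isAtom]
  exact N.orderIsoIic.isSimpleOrder_iff

omit [LieModule R L M] in
/-- A module is irreducible over an ideal as soon as the whole algebra acts on it through the
ideal and scalars. -/
lemma LieModule.IsIrreducible.of_lieIdeal [IsIrreducible R L M] (I : LieIdeal R L)
    (h : ∀ x : L, ∃ a ∈ I, ∃ c : R, ∀ y : M, ⁅x, y⁆ = ⁅a, y⁆ + c • y) : IsIrreducible R I M := by
  have := LieModule.nontrivial_of_isIrreducible R L M
  refine .mk fun N hN ↦ ?_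
  let N' : LieSubmodule R L M :=
    { N with
      lie_mem := fun {x y} hy ↦ by
        obtain ⟨a, ha, c, hc⟩ := h x
        rw [hc]
        exact add_mem (N.lie_mem (x := ⟨a, ha⟩) hy) (N.smul_mem c hy) }
  refine LieSubmodule.toSubmodule_injective ?_
  have h0 : N' ≠ ⊥ := fun h0 ↦ hN (LieSubmodule.toSubmodule_injective
    (congrArg LieSubmodule.toSubmodule h0 : _))
  have h1 : N' = ⊤ := (eq_bot_or_eq_top N').resolve_left h0
  have h2 : N'.toSubmodule = ⊤ := by rw [h1]; rfl
  exact h2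

end Submodules

/-! ### Assembling the statements about `𝔤_ν` and `𝔯` -/

section Main

open LieAlgebra LieAlgebra.IsKilling LieModule Module

variable {𝔤 : Type*} [LieRing 𝔤] [LieAlgebra ℂ 𝔤] [FiniteDimensional ℂ 𝔤]
  [LieAlgebra.IsSemisimple ℂ 𝔤] {H : LieSubalgebra ℂ 𝔤} [H.IsCartanSubalgebra]
  {m : LieSubalgebra ℂ 𝔤} {h₀ : H} {f : H.root → ℤ}

/-- The sum `𝔯` of the `𝔱`-root spaces. -/
def tRootSum (m : LieSubalgebra ℂ 𝔤) : LieSubmodule ℂ m 𝔤 := ⨆ ν : tRoots m, tRootSpace m ν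

namespace IsZeroPart

variable (hm : IsZeroPart m h₀ f)
include hm

lemma isAtom_tRootSpace {ν : Dual ℂ (center ℂ m)} (hν : ν ∈ tRoots m) :
    IsAtom (tRootSpace m ν) :=
  ⟨hν.2, fun N hN ↦ by
    by_contra h
    exact hN.ne (hm.eq_tRootSpace_of_le hν.1 hN.le h)⟩

lemma isIrreducible_tRootSpace {ν : Dual ℂ (center ℂ m)} (hν : ν ∈ tRoots m) :
    IsIrreducible ℂ m (tRootSpace m ν) :=
  (LieSubmodule.isIrreducible_iff_isAtom _).mpr (hm.isAtom_tRootSpace hν)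

lemma isIrreducible_derivedIdeal {ν : Dual ℂ (center ℂ m)} (hν : ν ∈ tRoots m) :
    IsIrreducible ℂ (derivedIdeal m) (tRootSpace m ν) := by
  have := hm.isIrreducible_tRootSpace hν
  refine .of_lieIdeal _ fun x ↦ ?_
  obtain ⟨a, ha, hc⟩ := hm.exists_sub_mem_center x
  refine ⟨a, ha, ν ⟨x - a, hc⟩, fun y ↦ ?_⟩
  have h1 : ⁅x - a, y⁆ = ν ⟨x - a, hc⟩ • y := Subtype.ext (y.2 ⟨x - a, hc⟩)
  rw [← h1, ← add_lie, add_sub_cancel]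

lemma isIrreducible_tRootBracket {ν : Dual ℂ (center ℂ m)} (hν : ν ∈ tRoots m) :
    IsIrreducible ℂ (tRootBracket m ν) (tRootSpace m ν) := by
  have := hm.isIrreducible_tRootSpace hν
  refine .of_lieIdeal _ fun x ↦ ?_
  obtain ⟨a, ha, hc⟩ := hm.exists_sub_lie_eq_zero ν x
  refine ⟨a, ha, 0, fun y ↦ ?_⟩
  have h1 : ⁅x - a, y⁆ = 0 := Subtype.ext (hc y y.2)
  rw [sub_lie, sub_eq_zero] at h1
  rw [h1, zero_smul, add_zero]

/-- Replacing `x` and `y` by elements of `[𝔤_ν, 𝔤_{-ν}]` acting alike does not change the action of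
`⁅x, y⁆`. So `[m, m]` acts through the intersection, and the center only adds scalars. -/
lemma isIrreducible_tRootBracket_inf {ν : Dual ℂ (center ℂ m)} (hν : ν ∈ tRoots m) :
    IsIrreducible ℂ (tRootBracket m ν ⊓ derivedIdeal m : LieIdeal ℂ m) (tRootSpace m ν) := by
  have := hm.isIrreducible_tRootSpace hν
  have hact (x : m) : ∃ a ∈ tRootBracket m ν, ∀ y : tRootSpace m ν, ⁅x, y⁆ = ⁅a, y⁆ := by
    obtain ⟨a, ha, hc⟩ := hm.exists_sub_lie_eq_zero ν x
    refine ⟨a, ha, fun y ↦ ?_⟩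
    have h1 : ⁅x - a, y⁆ = 0 := Subtype.ext (hc y y.2)
    rwa [sub_lie, sub_eq_zero] at h1
  have hle : derivedIdeal m ≤ (tRootBracket m ν ⊓ derivedIdeal m) ⊔
      LieModule.ker ℂ m (tRootSpace m ν) := by
    rw [derivedIdeal, LieSubmodule.lie_le_iff]
    intro x _ y _
    obtain ⟨a, ha, hxa⟩ := hact x
    obtain ⟨a', ha', hya'⟩ := hact y
    rw [← add_sub_cancel ⁅a, a'⁆ ⁅x, y⁆]
    refine add_mem (LieSubmodule.mem_sup_left ⟨(tRootBracket m ν).lie_mem ha',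
      LieSubmodule.lie_mem_lie (LieSubmodule.mem_top _) (LieSubmodule.mem_top _)⟩)
      (LieSubmodule.mem_sup_right ((LieModule.mem_ker _ _ _ _).mpr fun v ↦ ?_))
    rw [sub_lie, lie_lie, lie_lie, hxa, hya', hxa, hya', sub_self]
  refine .of_lieIdeal _ fun x ↦ ?_
  obtain ⟨b, hb, hc⟩ := hm.exists_sub_mem_center x
  obtain ⟨a, ha, k, hk, rfl⟩ := (LieSubmodule.mem_sup _ _ _).mp (hle hb)
  refine ⟨a, ha, ν ⟨x - (a + k), hc⟩, fun y ↦ ?_⟩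
  have h1 : ⁅x - (a + k), y⁆ = ν ⟨x - (a + k), hc⟩ • y := Subtype.ext (y.2 ⟨x - (a + k), hc⟩)
  have h2 : ⁅k, y⁆ = 0 := (LieModule.mem_ker _ _ _ _).mp hk y
  rw [← h1, sub_lie, add_lie, h2, add_zero, add_sub_cancel]

lemma isFaithful_tRootBracket (ν : Dual ℂ (center ℂ m)) :
    IsFaithful ℂ (tRootBracket m ν) (tRootSpace m ν) := by
  refine (LieModule.isFaithful_iff' _ _ _).mpr fun x hx ↦ Subtype.ext (Subtype.ext ?_)
  exact hm.eq_zero_of_mem_bracketSpan x.2 fun y hy ↦ congrArg Subtype.val (hx ⟨y, hy⟩)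

lemma isFaithful_tRootBracket_inf (ν : Dual ℂ (center ℂ m)) :
    IsFaithful ℂ (tRootBracket m ν ⊓ derivedIdeal m : LieIdeal ℂ m) (tRootSpace m ν) := by
  refine (LieModule.isFaithful_iff' _ _ _).mpr fun x hx ↦ Subtype.ext (Subtype.ext ?_)
  exact hm.eq_zero_of_mem_bracketSpan x.2.1 fun y hy ↦ congrArg Subtype.val (hx ⟨y, hy⟩)

omit [FiniteDimensional ℂ 𝔤] [IsSemisimple ℂ 𝔤] [H.IsCartanSubalgebra] hm in
lemma tRootSpace_le_tRootSum {ν : Dual ℂ (center ℂ m)} (hν : ν ∈ tRoots m) :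
    tRootSpace m ν ≤ tRootSum m :=
  le_iSup (fun ν : tRoots m ↦ tRootSpace m ν) ⟨ν, hν⟩

lemma rootSpace_le_tRootSum {α : H.root} (hα : f α ≠ 0) :
    (rootSpace H α.1).toSubmodule ≤ (tRootSum m).toSubmodule := by
  have hν : weightRestrict hm.cartan_le α.1 ∈ tRoots m := by
    refine ⟨(hm.weightRestrict_eq_zero_iff α).not.mpr hα, fun h ↦ ?_⟩
    exact hm.tRootSpace_weightRestrict_ne_bot α.1 (by rw [h]; rfl)
  exact fun z hz ↦ tRootSpace_le_tRootSum hν (mem_tRootSpace_of_mem_rootSpace hm.cartan_le hz)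

omit [IsSemisimple ℂ 𝔤] [H.IsCartanSubalgebra] hm in
lemma disjoint_tRootSpace_zero_tRootSum : Disjoint (tRootSpace m 0) (tRootSum m) :=
  (iSupIndep_tRootSpace m 0).mono_right
    (iSup_le fun ν ↦ le_iSup₂_of_le (ν : Dual ℂ (center ℂ m)) ν.2.1 le_rfl)

/-- A weight vector of `N` lies in some `𝔤_ν`, so the atom `N` is contained in it. Here `ν ≠ 0`,
because `𝔤_0` meets the sum trivially. -/
lemma exists_eq_tRootSpace_of_isAtom {N : LieSubmodule ℂ m 𝔤} (hN : IsAtom N)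
    (hle : N ≤ tRootSum m) : ∃ ν ∈ tRoots m, N = tRootSpace m ν := by
  obtain ⟨χ, z, hzN, hzχ, hz0⟩ := exists_mem_rootSpace_of_ne_bot hm.cartan_le hN.1
  let ν := weightRestrict hm.cartan_le χ
  have hzν : z ∈ tRootSpace m ν := mem_tRootSpace_of_mem_rootSpace hm.cartan_le hzχ
  have hν : ν ≠ 0 := by
    intro h
    rw [h] at hzν
    have h1 : z ∈ tRootSpace m 0 ⊓ tRootSum m := ⟨hzν, hle hzN⟩
    rw [disjoint_tRootSpace_zero_tRootSum.eq_bot, LieSubmodule.mem_bot] at h1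
    exact hz0 h1
  have hNν : N ≤ tRootSpace m ν := by
    rcases hN.le_iff.mp (inf_le_left : N ⊓ tRootSpace m ν ≤ N) with h | h
    · have h1 : z ∈ N ⊓ tRootSpace m ν := ⟨hzN, hzν⟩
      rw [h, LieSubmodule.mem_bot] at h1
      exact absurd h1 hz0
    · exact inf_eq_left.mp h
  refine ⟨ν, ⟨hν, ne_bot_of_le_ne_bot hN.1 hNν⟩, hm.eq_tRootSpace_of_le hν hNν hN.1⟩

lemma isMultiplicityFree_tRootSum : IsMultiplicityFree m (tRootSum m) := by
  constructor
  · refine (tRootSum m).orderIsoIic.complementedLattice_iff.mpr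
      (complementedLattice_of_sSup_atoms_eq_top ?_)
    rw [eq_top_iff]
    change tRootSum m ≤ (sSup {a : Set.Iic (tRootSum m) | IsAtom a}).1
    refine iSup_le fun ν ↦ ?_
    have h1 : (⟨tRootSpace m ν, tRootSpace_le_tRootSum ν.2⟩ : Set.Iic (tRootSum m)) ≤
        sSup {a : Set.Iic (tRootSum m) | IsAtom a} :=
      le_sSup ((hm.isAtom_tRootSpace ν.2).Iic _)
    exact h1
  · intro N N' hN hN' ⟨e⟩
    have key {N : LieSubmodule ℂ m (tRootSum m)} (hN : IsIrreducible ℂ m N) :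
        ∃ ν ∈ tRoots m, ((tRootSum m).orderIsoIic N).1 = tRootSpace m ν := by
      rw [LieSubmodule.isIrreducible_iff_isAtom, ← (tRootSum m).orderIsoIic.isAtom_iff] at hN
      exact hm.exists_eq_tRootSpace_of_isAtom hN.of_isAtom_coe_Iic ((tRootSum m).orderIsoIic N).2
    obtain ⟨ν, hν, h⟩ := key hN
    obtain ⟨ν', -, h'⟩ := key hN'
    suffices hνν' : ν = ν' by
      subst hνν'
      exact (tRootSum m).orderIsoIic.injective (Subtype.ext (h.trans h'.symm))
    have := LieModule.nontrivial_of_isIrreducible ℂ m N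
    obtain ⟨y, hy⟩ := exists_ne (0 : N)
    have hact {N : LieSubmodule ℂ m (tRootSum m)} {μ : Dual ℂ (center ℂ m)}
        (hN : ((tRootSum m).orderIsoIic N).1 = tRootSpace m μ) (x : center ℂ m) (y : N) :
        ⁅(x : m), y⁆ = μ x • y := by
      have hmem : ((y : tRootSum m) : 𝔤) ∈ ((tRootSum m).orderIsoIic N).1 := ⟨y, y.2, rfl⟩
      rw [hN] at hmem
      exact Subtype.ext (Subtype.ext (hmem x))
    -- The isomorphism commutes with the center, which acts by `ν` on one side and `ν'` on the
    -- other.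
    ext x
    have h1 : ν x • e y = ν' x • e y := by
      have h2 : e ⁅(x : m), y⁆ = ⁅(x : m), e y⁆ := e.toLieModuleHom.map_lie _ _
      rw [← hact h' x (e y), ← h2, hact h x y]
      exact (e.toLinearEquiv.map_smul _ _).symm
    exact smul_left_injective ℂ ((map_ne_zero_iff e e.injective).mpr hy) h1

lemma toSubmodule_tRootSum {q : LieSubalgebra ℂ 𝔤}
    (hn : nilradicalSubmodule q = gradedPartGE (h₀ : 𝔤) 1) :
    (tRootSum m).toSubmodule = nilradicalSubmodule q ⊔ oppositeNilradical H q := by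
  have hpos {α : H.root} : (rootSpace H α.1).toSubmodule ≤ nilradicalSubmodule q ↔ 0 < f α := by
    rw [hn]
    refine ⟨fun h ↦ ?_, fun h ↦ rootSpace_le_gradedPartGE hm.apply_eq h⟩
    by_contra hα
    obtain ⟨e, he, he0⟩ := α.1.exists_ne_zero
    refine he0 (eq_zero_of_mem_rootSpace_of_mem_iSup he ?_
      (gradedPartGE_le_iSup_rootSpace hm.apply_eq one_pos (h he)))
    rintro ⟨β, hβ, hβ'⟩
    obtain rfl := Subtype.ext hβ
    lia
  refine le_antisymm ?_ (sup_le ?_ ?_)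
  · rw [tRootSum, LieSubmodule.iSup_toSubmodule]
    refine iSup_le fun ν ↦ LieSubmodule.le_of_forall_mem_rootSpace hm.cartan_le fun χ z hz hzχ ↦ ?_
    by_cases hz0 : z = 0
    · simp [hz0]
    have hν := eq_weightRestrict hm.cartan_le hzχ hz0 hz
    have hχ : χ.IsNonZero := fun hχ ↦
      ν.2.1 (hν.trans (weightRestrict_of_isZero hm.cartan_le hχ))
    let α : H.root := ⟨χ, by simpa using hχ⟩
    have hα : f α ≠ 0 := (hm.weightRestrict_eq_zero_iff α).not.mp fun h ↦ ν.2.1 (hν.trans h)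
    rcases hα.lt_or_gt with h | h
    · refine Submodule.mem_sup_right (Submodule.subset_span ⟨(negRoot α).1, (negRoot α).2,
        hpos.mpr (by rw [apply_negRoot hm.apply_eq]; lia), ?_⟩)
      have h1 : (-(negRoot α).1 : H → ℂ) = χ := neg_neg (χ : H → ℂ)
      rwa [h1]
    · exact Submodule.mem_sup_left (hpos.mpr h hzχ)
  · rw [hn]
    refine (gradedPartGE_le_iSup_rootSpace hm.apply_eq one_pos).trans (iSup₂_le ?_)
    rintro _ ⟨α, rfl, hα⟩
    exact hm.rootSpace_le_tRootSum (by lia)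
  · refine Submodule.span_le.mpr ?_
    rintro x ⟨φ, hφ, hφn, hx⟩
    have h1 : 0 < f ⟨φ, hφ⟩ := hpos.mp hφn
    exact hm.rootSpace_le_tRootSum (α := negRoot ⟨φ, hφ⟩)
      (by rw [apply_negRoot hm.apply_eq]; lia) hx

end IsZeroPart

end Main

theorem theorem1p9 {𝔤 : Type*} [LieRing 𝔤] [LieAlgebra ℂ 𝔤] [FiniteDimensional ℂ 𝔤]
    [LieAlgebra.IsSemisimple ℂ 𝔤]
    (H : LieSubalgebra ℂ 𝔤) [H.IsCartanSubalgebra]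
    (b : (LieAlgebra.IsKilling.rootSystem H).Base)
    (q : LieSubalgebra ℂ 𝔤) (hbq : borelOfBase H b ≤ q) (hq : q ≠ ⊤)
    (m : LieSubalgebra ℂ 𝔤) (hm : IsLeviFactor q m) (hHm : H ≤ m) :
    (∀ ν ∈ tRoots m,
      LieModule.IsIrreducible ℂ m (tRootSpace m ν) ∧
      LieModule.IsIrreducible ℂ (derivedIdeal m) (tRootSpace m ν) ∧
      (∀ y ∈ tRootSpace m ν, ∀ z ∈ tRootSpace m (-ν), ⁅y, z⁆ ∈ m) ∧
      LieModule.IsIrreducible ℂ (tRootBracket m ν) (tRootSpace m ν) ∧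
      LieModule.IsFaithful ℂ (tRootBracket m ν) (tRootSpace m ν) ∧
      LieModule.IsIrreducible ℂ
        (tRootBracket m ν ⊓ derivedIdeal m : LieIdeal ℂ m) (tRootSpace m ν) ∧
      LieModule.IsFaithful ℂ
        (tRootBracket m ν ⊓ derivedIdeal m : LieIdeal ℂ m) (tRootSpace m ν)) ∧
    ∃ r : LieSubmodule ℂ m 𝔤,
      r.toSubmodule = nilradicalSubmodule q ⊔ oppositeNilradical H q ∧
      r = (⨆ ν : tRoots m, tRootSpace m ν) ∧
      iSupIndep (fun ν : tRoots m => tRootSpace m ν) ∧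
      IsMultiplicityFree m r ∧
      ∀ N : LieSubmodule ℂ m 𝔤,
        (N ≤ r ∧ LieModule.IsIrreducible ℂ m N) ↔ ∃ ν ∈ tRoots m, N = tRootSpace m ν := by
  obtain ⟨h₀, f, hf, hfq⟩ := exists_grading_of_borelOfBase_le hbq
  have hHq : H ≤ q := (cartan_le_borelOfBase b).trans hbq
  have hz : IsZeroPart m h₀ f := ⟨hHm, hf, rootSpace_le_iff_of_isLeviFactor hf hHq hfq hm hHm⟩
  refine ⟨fun ν hν ↦ ⟨hz.isIrreducible_tRootSpace hν, hz.isIrreducible_derivedIdeal hν,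
    fun y hy z hz' ↦ hz.lie_mem_of_mem_tRootSpace hy hz', hz.isIrreducible_tRootBracket hν,
    hz.isFaithful_tRootBracket ν, hz.isIrreducible_tRootBracket_inf hν,
    hz.isFaithful_tRootBracket_inf ν⟩, tRootSum m,
    hz.toSubmodule_tRootSum (nilradicalSubmodule_eq_gradedPartGE hf hHq hfq), rfl,
    (iSupIndep_tRootSpace m).comp Subtype.val_injective, hz.isMultiplicityFree_tRootSum,
    fun N ↦ ⟨fun ⟨hle, hN⟩ ↦ ?_, ?_⟩⟩
  · exact hz.exists_eq_tRootSpace_of_isAtom ((LieSubmodule.isIrreducible_iff_isAtom N).mp hN) hle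
  · rintro ⟨ν, hν, rfl⟩
    exact ⟨IsZeroPart.tRootSpace_le_tRootSum hν, hz.isIrreducible_tRootSpace hν⟩
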